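/- Let $G=\mathbb Z$ be the integer line ($x,y$ adjacent iff $|x-y|=1$). For $x\in\mathbb Z$ let $\tilde N(x)=\{x-1,x,x+1\}$ (the neighbours of $x$, together with $x$ itself because its degree is even). Each site carries an independent rate-one Poisson clock, independent of the initial opinions, and opinions change only at clock rings. In *majority dynamics* $(\xi^p_t)_{t\ge 0}$, $p\in[0,1]$, the initial opinions are i.i.d. Bernoulli($p$) in $\{0,1\}$, and when the clock at $x$ rings the opinion of $x$ becomes the most common opinion in $\tilde N(x)$. In *median dynamics* $(\eta_t)_{t\ge 0}$ the initial opinions are i.i.d. uniform on $[0,1]$, and when the clock at $x$ rings the opinion of $x$ becomes the median of the opinions in $\tilde N(x)$. **Proposition.** For all $x\in\mathbb Z$, $t\ge 0$ and $p\in[0,1]$, $$\mathbb P[\xi^p_t(x)=1]=\mathbb P[\eta_t(x)\le p]=3p^2-2p^3-e^{-t}\,p(1-p)(2p-1).$$ Moreover, for every $x\in\mathbb Z$: 1. (Monotonicity in time.) For every $p\in[0,\tfrac12]$ the function $t\mapsto\mathbb P[\xi^p_t(x)=1]$ is non-increasing on $[0,\infty)$, and for every $\alpha\in[0,\tfrac12]$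 the function $t\mapsto\mathbb P[\eta_t(x)\in[0,\alpha)]$ is non-increasing on $[0,\infty)$. 2. (Convexity and unimodality.) For every $t\ge0$ the function $p\mapsto\mathbb P[\xi^p_t(x)=1]$ is convex on $[0,\tfrac12]$, and the law of $\eta_t(x)$ has a density on $[0,1]$ that is symmetric around $\tfrac12$ and non-decreasing on $[0,\tfrac12]$. -/

import Mathlib

open MeasureTheory Filter Topology
open scoped NNReal ENNReal unitInterval

noncomputable section

namespace MedianDynamics

/-! ### Pools of opinions, median and majority -/

section Rules

variable {V : Type*} [DecidableEq V] (G : SimpleGraph V) [G.LocallyFinite]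

/-- The sites whose opinions are consulted when `x` updates: the neighbours of `x`, together with
`x` itself if the degree of `x` is even. It always has an odd number of elements. -/
def pool (x : V) : Finset V :=
  if Even (G.degree x) then insert x (G.neighborFinset x) else G.neighborFinset x

/-- The median of the opinions `η z`, `z ∈ A`, counted with multiplicity: the middle entry of the
sorted list of opinions (`A` has odd cardinality wherever this is used, so that the default value
`0` of `getD` is never reached). -/
def median (A : Finset V) (η : V → I) : I :=
  ((A.val.map η).sort (· ≤ ·)).getD (A.card / 2) 0

/-- The most common opinion among `ξ z`, `z ∈ A`, for opinions `true` (one) and `false` (zero);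
`A` has odd cardinality wherever this is used. -/
def majority (A : Finset V) (ξ : V → Bool) : Bool :=
  decide (A.card < 2 * (A.filter fun z => ξ z = true).card)

/-- The new opinion of `x` in median dynamics when the clock at `x` rings. -/
def medianRule (x : V) (η : V → I) : I := median (pool G x) η

/-- The new opinion of `x` in majority dynamics when the clock at `x` rings. -/
def majorityRule (x : V) (ξ : V → Bool) : Bool := majority (pool G x) ξ

end Rules

/-! ### The graphical construction -/

section Graphical

variable {V S : Type*}

/-- The times at which the clock at `x` rings, when `gap x 0, gap x 1, …` are the successive waiting
times of the clock at `x`: the partial sums `gap x 0 + ⋯ + gap x n`. -/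
def rings (gap : V → ℕ → ℝ) (x : V) : Set ℝ≥0 :=
  {t | ∃ n : ℕ, (t : ℝ) = ∑ i ∈ Finset.range (n + 1), gap x i}

/-- `η` evolves from the configuration `η₀` according to the clock rings `R` and the update rule
`rule`: the opinion at `x` changes only when the clock at `x` rings, and at a ring of `x` it
becomes the value that the rule gives for the configuration just before the ring. -/
structure IsTrajectory (rule : V → (V → S) → S) (R : V → Set ℝ≥0) (η₀ : V → S)
    (η : ℝ≥0 → V → S) : Prop where
  initial : η 0 = η₀
  const : ∀ (x : V) (s t : ℝ≥0), s ≤ t → (∀ r ∈ R x, ¬ (s < r ∧ r ≤ t)) → η t x = η s x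
  update : ∀ (x : V), ∀ t ∈ R x, ∀ᶠ u in 𝓝[<] t, η t x = rule x (η u)

open Classical in
/-- The evolution started from `η₀` with clock rings `R`. It is the unique trajectory; if there is
no trajectory or there are several (on the graphs considered here, an event of probability zero),
it is by convention the constant evolution. -/
def evolution (rule : V → (V → S) → S) (R : V → Set ℝ≥0) (η₀ : V → S) : ℝ≥0 → V → S :=
  if h : ∃! η : ℝ≥0 → V → S, IsTrajectory rule R η₀ η then h.choose else fun _ => η₀

/-- The joint law of the initial opinions, i.i.d. with law `ν`, and of the waiting times of
independent rate-one Poisson clocks at the sites, i.i.d. exponential with parameter one and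
independent of the initial opinions. -/
def graphicalLaw (V : Type*) {S : Type*} [MeasurableSpace S] (ν : Measure S) :
    Measure ((V → S) × (V → ℕ → ℝ)) :=
  (Measure.infinitePi fun _ : V => ν).prod
    (Measure.infinitePi fun _ : V => Measure.infinitePi fun _ : ℕ =>
      ProbabilityTheory.expMeasure 1)

/-- The law of the opinion of `x` at time `t`, for the interacting particle system with update rule
`rule`, rate-one clocks, and i.i.d. initial opinions of law `ν`. -/
def marginal [MeasurableSpace S] (rule : V → (V → S) → S) (ν : Measure S) (t : ℝ≥0) (x : V) :
    Measure S :=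
  (graphicalLaw V ν).map fun ω => evolution rule (rings ω.2) ω.1 t x

end Graphical

/-! ### Median dynamics and majority dynamics -/

section Processes

variable {V : Type*} [DecidableEq V] (G : SimpleGraph V) [G.LocallyFinite]

/-- The law `μ_t^x` of the opinion `η_t(x)` in median dynamics on `G`, started from i.i.d. uniform
opinions in `[0,1]`. -/
def medianMarginal (t : ℝ≥0) (x : V) : Measure I :=
  marginal (medianRule G) volume t x

/-- The probability that `ξ^p_t(x) = 1` in majority dynamics on `G`, started from i.i.d. Bernoulli
opinions with parameter `p`. -/
def majorityProb (p : I) (t : ℝ≥0) (x : V) : ℝ :=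
  (marginal (majorityRule G) (ProbabilityTheory.bernoulliMeasure true false p) t x).real {true}

end Processes

/-- The integer line: `x` and `y` are neighbours when `|x - y| = 1`. -/
def intLine : SimpleGraph ℤ where
  Adj x y := |x - y| = 1
  symm := ⟨fun x y h => by rw [abs_sub_comm]; exact h⟩
  loopless := ⟨fun x h => by simp at h⟩

instance : intLine.LocallyFinite := fun x =>
  Fintype.ofFinset {x - 1, x + 1} fun y => by
    simp only [Finset.mem_insert, Finset.mem_singleton, SimpleGraph.mem_neighborSet, intLine]
    rw [abs_eq (by norm_num)]
    omega

end MedianDynamics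

end

/-! On the line, a site changes its opinion only if both neighbours disagree with it, so two
adjacent sites that agree are frozen forever. After its first ring a site agrees with at least one
neighbour: either it already did and kept its opinion, or it has just joined both. Hence every site
can change only at its first ring, and majority dynamics is an explicit function `majorityPath` of
the initial opinions and first ring times (`GoodTimes.isTrajectory_majorityPath`).

Let `x` have initial opinion `c` and first ring time `s`. Until `s` the site `x` keeps `c`, so
whether the left neighbour disagrees with `x` just before `s` depends only on `c`, `s` and the sites
to the left of `x`; the same holds on the right. Given `(c, s)` the two sides are therefore
independent, and `x` flips with probability `f_c(s) ^ 2`, where `f_c` is `opposedProb`. Conditioning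
on the nearest site of one side gives `f_c(s) = P(!c) (1 - ∫₀ˢ e^{-u} f_{!c}(u) du)`
(`opposedProb_eq`).

This system need not be solved. It conserves `p f_1 ^ 2 - (1 - p) f_0 ^ 2`, which equals `p (1 - p)
(1 - 2p)` at time `0`, and this is exactly the net rate, relative to `e^{-u} du`, at which opinion
one is lost. So `P[ξ_t(x) = 1] = p - (1 - e^{-t}) p (1 - p) (1 - 2p)` (`real_majorityPath`).

Thresholding at `p` commutes with the median, which turns median dynamics into majority dynamics
with parameter `p` on the same clocks (`IsTrajectory.threshold`). The remaining claims are calculus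
on the resulting cubic. For the processes to be well defined, influence must not arrive from
infinity in finite time: almost surely there are sites on both sides, arbitrarily far away, that
have not rung yet. -/

noncomputable section

namespace MedianDynamics

/-! ### Well-posedness of the evolution on the integers -/

section WellPosed

variable {S : Type*} {R : ℤ → Set ℝ≥0} {rule : ℤ → (ℤ → S) → S}

/-- Rings of clocks on the integers for which every local rule defines a unique evolution: there
are no rings at time `0`, finitely many rings of each clock in bounded time, and, for every time
horizon, clocks arbitrarily far to the left and to the right which do not ring. -/
structure WellSpaced (R : ℤ → Set ℝ≥0) : Prop where
  pos : ∀ x, 0 ∉ R x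
  finite : ∀ x T, (R x ∩ Set.Iic T).Finite
  quiet_right : ∀ x T, ∃ y, x < y ∧ R y ∩ Set.Iic T = ∅
  quiet_left : ∀ x T, ∃ y, y < x ∧ R y ∩ Set.Iic T = ∅

/-- The update of a site depends only on the opinions of the site and its two neighbours. -/
def IsLocal (rule : ℤ → (ℤ → S) → S) : Prop :=
  ∀ x η η', (∀ y, |y - x| ≤ 1 → η y = η' y) → rule x η = rule x η'

/-- The ring `a` may influence the outcome of the ring `b`. -/
def Precedes (R : ℤ → Set ℝ≥0) (a b : ℝ≥0 × ℤ) : Prop :=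
  a.1 < b.1 ∧ a.1 ∈ R a.2 ∧ |a.2 - b.2| ≤ 1

/-- A descending chain moves by at most one site per step and cannot land on a quiet site, so it
stays between two quiet sites. Only finitely many ring times are available there, whereas the times
of the chain strictly decrease. -/
lemma WellSpaced.wellFounded_precedes (hR : WellSpaced R) : WellFounded (Precedes R) := by
  rw [wellFounded_iff_isEmpty_descending_chain]
  refine ⟨fun ⟨f, hf⟩ => ?_⟩
  obtain ⟨b, hb, hbq⟩ := hR.quiet_right (f 0).2 (f 0).1
  obtain ⟨a, ha, haq⟩ := hR.quiet_left (f 0).2 (f 0).1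
  have hanti : StrictAnti fun n => (f n).1 := strictAnti_nat_of_succ_lt fun n => (hf n).1
  have hle : ∀ n, (f n).1 ≤ (f 0).1 := fun n => hanti.antitone (Nat.zero_le n)
  have hmem : ∀ n, a < (f n).2 ∧ (f n).2 < b := by
    intro n
    induction n with
    | zero => exact ⟨ha, hb⟩
    | succ n ih =>
      obtain ⟨-, h2, h3⟩ := hf n
      have hna : (f (n + 1)).2 ≠ a := fun h =>
        Set.eq_empty_iff_forall_notMem.1 haq _ ⟨h ▸ h2, hle (n + 1)⟩
      have hnb : (f (n + 1)).2 ≠ b := fun h =>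
        Set.eq_empty_iff_forall_notMem.1 hbq _ ⟨h ▸ h2, hle (n + 1)⟩
      rw [abs_le] at h3
      omega
  have hfin : (⋃ z ∈ Set.Ioo a b, R z ∩ Set.Iic (f 0).1).Finite :=
    (Set.finite_Ioo a b).biUnion fun z _ => hR.finite z _
  refine Set.infinite_of_injective_forall_mem (f := fun n => (f (n + 1)).1)
    (fun m n h => ?_) (fun n => ?_) hfin
  · simpa using hanti.injective h
  · exact Set.mem_biUnion (hmem (n + 1)) ⟨(hf n).2.1, hle (n + 1)⟩

lemma WellSpaced.exists_isGreatest_Iio (hR : WellSpaced R) (y : ℤ) (r : ℝ≥0) :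
    (∃ s, IsGreatest (R y ∩ Set.Iio r) s) ∨ R y ∩ Set.Iio r = ∅ := by
  rcases Set.eq_empty_or_nonempty (R y ∩ Set.Iio r) with h | h
  · exact Or.inr h
  · have hf : (R y ∩ Set.Iio r).Finite :=
      (hR.finite y r).subset (Set.inter_subset_inter_right _ Set.Iio_subset_Iic_self)
    exact Or.inl ((Set.exists_max_image _ id hf h).imp fun s hs => ⟨hs.1, fun u hu => hs.2 u hu⟩)

lemma WellSpaced.exists_isGreatest_Iic (hR : WellSpaced R) (y : ℤ) (r : ℝ≥0) :
    (∃ s, IsGreatest (R y ∩ Set.Iic r) s) ∨ R y ∩ Set.Iic r = ∅ := by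
  rcases Set.eq_empty_or_nonempty (R y ∩ Set.Iic r) with h | h
  · exact Or.inr h
  · exact Or.inl ((Set.exists_max_image _ id (hR.finite y r) h).imp
      fun s hs => ⟨hs.1, fun u hu => hs.2 u hu⟩)

lemma IsTrajectory.eq_of_isGreatest {η₀ : ℤ → S} {η : ℝ≥0 → ℤ → S}
    (h : IsTrajectory rule R η₀ η) {y : ℤ} {t s : ℝ≥0} (hs : IsGreatest (R y ∩ Set.Iic t) s) :
    η t y = η s y :=
  h.const y s t hs.1.2 fun _ hr hlt => absurd (hs.2 ⟨hr, hlt.2⟩) (not_le.2 hlt.1)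

lemma IsTrajectory.eq_of_empty {η₀ : ℤ → S} {η : ℝ≥0 → ℤ → S}
    (h : IsTrajectory rule R η₀ η) {y : ℤ} {t : ℝ≥0} (hs : R y ∩ Set.Iic t = ∅) :
    η t y = η₀ y := by
  rw [h.const y 0 t zero_le fun r hr hlt =>
    Set.eq_empty_iff_forall_notMem.1 hs r ⟨hr, hlt.2⟩, h.initial]

/-- The last ring before `r`, if there is one, is also the last ring up to any time slightly
before `r`. -/
lemma isGreatest_Iic_of_Iio {A : Set ℝ≥0} {r s u : ℝ≥0} (hs : IsGreatest (A ∩ Set.Iio r) s)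
    (hsu : s ≤ u) (hu : u < r) : IsGreatest (A ∩ Set.Iic u) s :=
  ⟨⟨hs.1.1, hsu⟩, fun _ hv => hs.2 ⟨hv.1, lt_of_le_of_lt hv.2 hu⟩⟩

lemma empty_Iic_of_Iio {A : Set ℝ≥0} {r u : ℝ≥0} (hs : A ∩ Set.Iio r = ∅)
    (hu : u < r) : A ∩ Set.Iic u = ∅ :=
  Set.subset_empty_iff.1 (hs ▸ Set.inter_subset_inter_right _ (Set.Iic_subset_Iio.2 hu))

lemma neBot_nhdsLT {r : ℝ≥0} (hr : 0 < r) : (𝓝[<] r).NeBot :=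
  nhdsLT_neBot_of_exists_lt ⟨0, hr⟩

lemma eventually_Ico_nhdsLT {s r : ℝ≥0} (h : s < r) : ∀ᶠ u in 𝓝[<] r, s ≤ u ∧ u < r :=
  Ico_mem_nhdsLT h

lemma abs_sub_le_one_iff {x y : ℤ} : |y - x| ≤ 1 ↔ y = x - 1 ∨ y = x ∨ y = x + 1 := by
  rw [abs_le]; omega

/-- To prove a property for all neighbours at once, eventually. -/
lemma eventually_forall_neighbours {l : Filter ℝ≥0} {P : ℝ≥0 → ℤ → Prop} (x : ℤ)
    (h : ∀ y, |y - x| ≤ 1 → ∀ᶠ u in l, P u y) : ∀ᶠ u in l, ∀ y, |y - x| ≤ 1 → P u y := by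
  filter_upwards [h (x - 1) (by simp), h x (by simp), h (x + 1) (by simp)] with u h1 h2 h3 y hy
  rcases abs_sub_le_one_iff.1 hy with rfl | rfl | rfl <;> assumption

/-- By well-founded induction along `Precedes`: just before a ring, each consulted site holds the
opinion from its own last earlier ring, or its initial opinion if there is none. -/
lemma IsTrajectory.unique (hR : WellSpaced R) (hloc : IsLocal rule) {η₀ : ℤ → S}
    {η η' : ℝ≥0 → ℤ → S} (h : IsTrajectory rule R η₀ η) (h' : IsTrajectory rule R η₀ η') :
    η = η' := by
  have key : ∀ a : ℝ≥0 × ℤ, a.1 ∈ R a.2 → η a.1 a.2 = η' a.1 a.2 := by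
    intro a
    induction a using hR.wellFounded_precedes.induction with
    | _ a ih =>
    obtain ⟨r, x⟩ := a
    intro hr
    have hr0 : 0 < r := pos_iff_ne_zero.2 fun h0 => hR.pos x (h0 ▸ hr)
    have hev : ∀ᶠ u in 𝓝[<] r, ∀ y, |y - x| ≤ 1 → η u y = η' u y := by
      refine eventually_forall_neighbours x fun y hy => ?_
      rcases hR.exists_isGreatest_Iio y r with ⟨s, hs⟩ | he
      · filter_upwards [eventually_Ico_nhdsLT hs.1.2] with u hu
        have hg := isGreatest_Iic_of_Iio hs hu.1 hu.2
        rw [h.eq_of_isGreatest hg, h'.eq_of_isGreatest hg]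
        exact ih (s, y) ⟨hs.1.2, hs.1.1, hy⟩ hs.1.1
      · filter_upwards [eventually_Ico_nhdsLT hr0] with u hu
        rw [h.eq_of_empty (empty_Iic_of_Iio he hu.2), h'.eq_of_empty (empty_Iic_of_Iio he hu.2)]
    have := neBot_nhdsLT hr0
    obtain ⟨u, hu, hu1, hu2⟩ := (hev.and ((h.update x r hr).and (h'.update x r hr))).exists
    rw [hu1, hu2]
    exact hloc x _ _ hu
  funext t x
  rcases hR.exists_isGreatest_Iic x t with ⟨s, hs⟩ | he
  · rw [h.eq_of_isGreatest hs, h'.eq_of_isGreatest hs]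
    exact key (s, x) hs.1.1
  · rw [h.eq_of_empty he, h'.eq_of_empty he]

open Classical in
/-- The opinion adopted at a ring, by recursion along the rings which may influence it. -/
def ringValue (rule : ℤ → (ℤ → S) → S) (hR : WellSpaced R) (η₀ : ℤ → S) : ℝ≥0 × ℤ → S :=
  hR.wellFounded_precedes.fix fun a F => rule a.2 fun y =>
    -- For sites at distance more than one the initial opinion is only a filler, which a local rule
    -- ignores.
    if h : (∃ s, IsGreatest (R y ∩ Set.Iio a.1) s) ∧ |y - a.2| ≤ 1 then
      F (h.1.choose, y) ⟨h.1.choose_spec.1.2, h.1.choose_spec.1.1, h.2⟩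
    else η₀ y

open Classical in
lemma ringValue_eq (hR : WellSpaced R) (η₀ : ℤ → S) (r : ℝ≥0) (x : ℤ) :
    ringValue rule hR η₀ (r, x) = rule x fun y =>
      if h : (∃ s, IsGreatest (R y ∩ Set.Iio r) s) ∧ |y - x| ≤ 1 then
        ringValue rule hR η₀ (h.1.choose, y) else η₀ y := by
  rw [ringValue, WellFounded.fix_eq]

-- The opinion at time `t` is the one adopted at the last ring up to `t`; the recursion defining
-- `ringValue` then matches the update condition.
open Classical in
lemma exists_isTrajectory (hR : WellSpaced R) (hloc : IsLocal rule) (η₀ : ℤ → S) :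
    ∃ η, IsTrajectory rule R η₀ η := by
  let η : ℝ≥0 → ℤ → S := fun t x =>
    if h : ∃ s, IsGreatest (R x ∩ Set.Iic t) s then ringValue rule hR η₀ (h.choose, x) else η₀ x
  have hη : ∀ {t x s}, IsGreatest (R x ∩ Set.Iic t) s → η t x = ringValue rule hR η₀ (s, x) := by
    intro t x s hs
    have h : ∃ s, IsGreatest (R x ∩ Set.Iic t) s := ⟨s, hs⟩
    simp only [η, dif_pos h, h.choose_spec.unique hs]
  have hη' : ∀ {t x}, R x ∩ Set.Iic t = ∅ → η t x = η₀ x := by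
    intro t x he
    have h : ¬ ∃ s, IsGreatest (R x ∩ Set.Iic t) s := by
      rintro ⟨s, hs⟩
      exact Set.eq_empty_iff_forall_notMem.1 he s hs.1
    simp only [η, dif_neg h]
  refine ⟨η, ⟨?_, ?_, ?_⟩⟩
  · funext x
    refine hη' (Set.eq_empty_iff_forall_notMem.2 fun s hs => hR.pos x ?_)
    rw [← nonpos_iff_eq_zero.1 hs.2]
    exact hs.1
  · intro x s t hst hno
    have : R x ∩ Set.Iic t = R x ∩ Set.Iic s := by
      ext r
      exact ⟨fun hr => ⟨hr.1, not_lt.1 fun hlt => hno r hr.1 ⟨hlt, hr.2⟩⟩,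
        fun hr => ⟨hr.1, le_trans hr.2 hst⟩⟩
    simp only [η, this]
  · intro x r hr
    have hr0 : 0 < r := pos_iff_ne_zero.2 fun h0 => hR.pos x (h0 ▸ hr)
    rw [hη (s := r) ⟨⟨hr, Set.self_mem_Iic⟩, fun u hu => hu.2⟩, ringValue_eq]
    have hev : ∀ᶠ u in 𝓝[<] r, ∀ y, |y - x| ≤ 1 →
        (if h : (∃ s, IsGreatest (R y ∩ Set.Iio r) s) ∧ |y - x| ≤ 1 then
          ringValue rule hR η₀ (h.1.choose, y) else η₀ y) = η u y := by
      refine eventually_forall_neighbours x fun y hy => ?_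
      rcases hR.exists_isGreatest_Iio y r with h | he
      · filter_upwards [eventually_Ico_nhdsLT h.choose_spec.1.2] with u hu
        rw [dif_pos ⟨h, hy⟩, hη (isGreatest_Iic_of_Iio h.choose_spec hu.1 hu.2)]
      · filter_upwards [eventually_Ico_nhdsLT hr0] with u hu
        rw [hη' (empty_Iic_of_Iio he hu.2), dif_neg]
        rintro ⟨⟨s, hs⟩, -⟩
        exact Set.eq_empty_iff_forall_notMem.1 he s hs.1
    filter_upwards [hev] with u hu
    exact hloc x _ _ hu

lemma existsUnique_isTrajectory (hR : WellSpaced R) (hloc : IsLocal rule) (η₀ : ℤ → S) :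
    ∃! η, IsTrajectory rule R η₀ η := by
  obtain ⟨η, hη⟩ := exists_isTrajectory hR hloc η₀
  exact ⟨η, hη, fun η' h' => h'.unique hR hloc hη⟩

lemma isTrajectory_evolution (hR : WellSpaced R) (hloc : IsLocal rule) (η₀ : ℤ → S) :
    IsTrajectory rule R η₀ (evolution rule R η₀) := by
  have h := existsUnique_isTrajectory hR hloc η₀
  rw [evolution, dif_pos h]
  exact h.choose_spec.1

lemma IsTrajectory.evolution_eq (hR : WellSpaced R) (hloc : IsLocal rule) {η₀ : ℤ → S}
    {η : ℝ≥0 → ℤ → S} (h : IsTrajectory rule R η₀ η) : evolution rule R η₀ = η :=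
  (isTrajectory_evolution hR hloc η₀).unique hR hloc h

end WellPosed

/-! ### Thresholds of median dynamics -/

section Threshold

/-- In a sorted list the entries at most `a` form an initial segment, so entry `k` belongs to it
exactly when the segment has more than `k` members. -/
lemma _root_.List.Pairwise.getD_le_iff {α : Type*} [LinearOrder α] {l : List α}
    (hl : l.Pairwise (· ≤ ·)) (a d : α) {k : ℕ} (hk : k < l.length) :
    l.getD k d ≤ a ↔ k < l.countP (· ≤ a) := by
  induction l generalizing k with
  | nil => simp at hk
  | cons b l ih =>
    rw [List.pairwise_cons] at hl
    by_cases hb : b ≤ a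
    · cases k with
      | zero => simp [hb]
      | succ k => simpa [hb] using ih hl.2 (by simpa using hk)
    · have h0 : l.countP (· ≤ a) = 0 := by
        rw [List.countP_eq_zero]
        intro c hc
        simpa using lt_of_lt_of_le (not_le.1 hb) (hl.1 c hc)
      cases k with
      | zero => simp [hb, h0]
      | succ k =>
        have := ih hl.2 (k := k) (by simpa using hk)
        simp only [h0] at this
        simp [hb, h0]
        simpa using this

variable {V : Type*}

/-- With `2k + 1` opinions the median is entry `k`, and more than `k` opinions form a strict
majority. -/
lemma median_le_iff {A : Finset V} (hA : Odd A.card) (η : V → I) (p : I) :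
    median A η ≤ p ↔ majority A (fun z => decide (η z ≤ p)) = true := by
  have hlen : A.card / 2 < ((A.val.map η).sort (· ≤ ·)).length := by
    simp only [Multiset.length_sort, Multiset.card_map, Finset.card_val]
    obtain ⟨k, hk⟩ := hA
    omega
  rw [median, (Multiset.pairwise_sort _ _).getD_le_iff p 0 hlen, majority, decide_eq_true_iff]
  have : ((A.val.map η).sort (· ≤ ·)).countP (· ≤ p) =
      (A.filter fun z => decide (η z ≤ p) = true).card := by
    rw [← Multiset.coe_countP, Multiset.sort_eq, Multiset.countP_map]
    simp [Finset.card, Finset.filter]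
  rw [this]
  obtain ⟨k, hk⟩ := hA
  omega

/-- One median trajectory thus carries majority trajectories for all thresholds simultaneously,
driven by the same clocks. -/
lemma IsTrajectory.threshold [DecidableEq V] {G : SimpleGraph V} [G.LocallyFinite]
    (hG : ∀ x, Odd (pool G x).card) {R : V → Set ℝ≥0}
    {η₀ : V → I} {η : ℝ≥0 → V → I} (h : IsTrajectory (medianRule G) R η₀ η) (p : I) :
    IsTrajectory (majorityRule G) R (fun x => decide (η₀ x ≤ p))
      (fun t x => decide (η t x ≤ p)) where
  initial := by simp only [h.initial]
  const x s t hst hno := by simp only [h.const x s t hst hno]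
  update x t ht := by
    filter_upwards [h.update x t ht] with u hu
    rw [hu, majorityRule, Bool.eq_iff_iff, ← median_le_iff (hG x), medianRule, decide_eq_true_iff]

lemma pool_intLine (x : ℤ) : pool intLine x = {x - 1, x, x + 1} := by
  have hn : intLine.neighborFinset x = {x - 1, x + 1} := by
    ext y
    rw [SimpleGraph.mem_neighborFinset]
    simp only [Finset.mem_insert, Finset.mem_singleton, intLine]
    rw [abs_eq (by norm_num)]
    omega
  have hd : intLine.degree x = 2 := by
    rw [← SimpleGraph.card_neighborFinset_eq_degree, hn, Finset.card_pair (by omega)]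
  rw [pool, hd, if_pos even_two, hn]
  ext y
  simp only [Finset.mem_insert, Finset.mem_singleton]
  tauto

lemma card_pool_intLine (x : ℤ) : (pool intLine x).card = 3 := by
  rw [pool_intLine, Finset.card_eq_three]
  exact ⟨x - 1, x, x + 1, by omega, by omega, by omega, rfl⟩

lemma odd_card_pool_intLine (x : ℤ) : Odd (pool intLine x).card := by
  rw [card_pool_intLine]; decide

lemma mem_pool_intLine {x y : ℤ} : y ∈ pool intLine x ↔ |y - x| ≤ 1 := by
  rw [pool_intLine, abs_sub_le_one_iff]
  simp

lemma isLocal_medianRule : IsLocal (medianRule intLine) := by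
  intro x η η' h
  simp only [medianRule, median]
  rw [Multiset.map_congr rfl fun y hy => h y (mem_pool_intLine.1 hy)]

lemma isLocal_majorityRule : IsLocal (majorityRule intLine) := by
  intro x η η' h
  simp only [majorityRule, majority]
  rw [Finset.filter_congr fun y hy => by rw [h y (mem_pool_intLine.1 hy)]]

/-- On the integers the opinion of `x` changes to its opposite exactly if both neighbours
disagree with it. -/
lemma majorityRule_intLine (x : ℤ) (ξ : ℤ → Bool) :
    majorityRule intLine x ξ =
      if ξ (x - 1) ≠ ξ x ∧ ξ (x + 1) ≠ ξ x then !ξ x else ξ x := by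
  rw [majorityRule, majority, card_pool_intLine, pool_intLine, Finset.filter_insert,
    Finset.filter_insert, Finset.filter_singleton]
  have h1 : x - 1 ≠ x := by omega
  have h2 : x ≠ x + 1 := by omega
  have h3 : x - 1 ≠ x + 1 := by omega
  cases ha : ξ (x - 1) <;> cases hb : ξ x <;> cases hc : ξ (x + 1) <;> simp_all

lemma median_evolution_le_iff {R : ℤ → Set ℝ≥0} (hR : WellSpaced R) (η₀ : ℤ → I) (p : I)
    (t : ℝ≥0) (x : ℤ) :
    evolution (medianRule intLine) R η₀ t x ≤ p ↔
      evolution (majorityRule intLine) R (fun y => decide (η₀ y ≤ p)) t x = true := by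
  rw [((isTrajectory_evolution hR isLocal_medianRule η₀).threshold odd_card_pool_intLine
    p).evolution_eq hR isLocal_majorityRule, decide_eq_true_iff]

end Threshold


/-! ### The explicit form of majority dynamics on the integers -/

section Explicit

/-- Depth `n` approximation of `Opposed`. -/
def OpposedUpTo : ℕ → Bool → ℝ → (ℕ → Bool × ℝ) → Prop
  -- This value is irrelevant in the limit: the recursion is cut at the first site that does not
  -- ring before its predecessor.
  | 0, _, _, _ => True
  | n + 1, c, s, z =>
    (z 0).1 ≠ c ∧ ¬ ((z 0).2 < s ∧ OpposedUpTo n (z 0).1 (z 0).2 fun k => z (k + 1))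

/-- Let `z` list the initial opinions and the first ring times of the sites on one side of a site
with initial opinion `c`. This says that the nearest site on that side disagrees with `c` just
before time `s`, if `c` itself is kept until then. -/
def Opposed (c : Bool) (s : ℝ) (z : ℕ → Bool × ℝ) : Prop :=
  ∀ᶠ n in atTop, OpposedUpTo n c s z

/-- Beyond any place of the sequence there are arbitrarily large times. -/
def LateTimes (z : ℕ → Bool × ℝ) : Prop :=
  ∀ (m : ℕ) (T : ℝ), ∃ i, m ≤ i ∧ T < (z i).2

lemma LateTimes.tail {z : ℕ → Bool × ℝ} (h : LateTimes z) : LateTimes fun k => z (k + 1) := by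
  intro m T
  obtain ⟨i, hi, hT⟩ := h (m + 1) T
  exact ⟨i - 1, by omega, by simpa only [Nat.sub_add_cancel (show 1 ≤ i by omega)] using hT⟩

lemma LateTimes.exists_ascent {z : ℕ → Bool × ℝ} (h : LateTimes z) :
    ∃ i, (z i).2 ≤ (z (i + 1)).2 := by
  by_contra! hlt
  have hanti : StrictAnti fun i => (z i).2 := strictAnti_nat_of_succ_lt hlt
  obtain ⟨i, -, hi⟩ := h 0 (z 0).2
  exact absurd (hanti.antitone (Nat.zero_le i)) (not_le.2 hi)

/-- Influence travels inwards only along ring times that decrease outwards. An ascent at `i` stops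
it, so depths from `i + 2` on give the same answer. -/
lemma opposedUpTo_congr {i : ℕ} : ∀ {z : ℕ → Bool × ℝ}, (z i).2 ≤ (z (i + 1)).2 →
    ∀ (c : Bool) (s : ℝ) {m n : ℕ}, i + 2 ≤ m → i + 2 ≤ n →
    (OpposedUpTo m c s z ↔ OpposedUpTo n c s z) := by
  induction i with
  | zero =>
    intro z hz c s m n hm hn
    obtain ⟨m, rfl⟩ := Nat.exists_eq_add_of_le' hm
    obtain ⟨n, rfl⟩ := Nat.exists_eq_add_of_le' hn
    simp only [zero_add] at hz
    simp only [OpposedUpTo, zero_add, not_lt.2 hz, false_and, not_false_eq_true, and_true]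
  | succ i ih =>
    intro z hz c s m n hm hn
    obtain ⟨m, rfl⟩ := Nat.exists_eq_add_of_le' (show 1 ≤ m by omega)
    obtain ⟨n, rfl⟩ := Nat.exists_eq_add_of_le' (show 1 ≤ n by omega)
    rw [OpposedUpTo, OpposedUpTo, ih (z := fun k => z (k + 1)) hz (z 0).1 (z 0).2
      (show i + 2 ≤ m by omega) (show i + 2 ≤ n by omega)]

lemma LateTimes.exists_opposed_iff {z : ℕ → Bool × ℝ} (h : LateTimes z) (c : Bool) (s : ℝ) :
    ∃ N, ∀ n, N ≤ n → (Opposed c s z ↔ OpposedUpTo n c s z) := by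
  obtain ⟨i, hi⟩ := h.exists_ascent
  refine ⟨i + 2, fun n hn => ⟨fun ho => ?_, fun ho => ?_⟩⟩
  · obtain ⟨m, hm, hm'⟩ := (ho.and (eventually_ge_atTop (i + 2))).exists
    exact (opposedUpTo_congr hi c s hm' hn).1 hm
  · filter_upwards [eventually_ge_atTop (i + 2)] with m hm
    exact (opposedUpTo_congr hi c s hn hm).1 ho

lemma LateTimes.opposed_iff {z : ℕ → Bool × ℝ} (h : LateTimes z) (c : Bool) (s : ℝ) :
    Opposed c s z ↔ (z 0).1 ≠ c ∧
      ¬ ((z 0).2 < s ∧ Opposed (z 0).1 (z 0).2 fun k => z (k + 1)) := by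
  obtain ⟨N, hN⟩ := h.exists_opposed_iff c s
  obtain ⟨N', hN'⟩ := h.tail.exists_opposed_iff (z 0).1 (z 0).2
  -- The depths differ by one because unfolding the recursion once uses up one level.
  rw [hN (max N N' + 1) (by omega), hN' (max N N') (by omega), OpposedUpTo]

/-- The sites to the left of `x`, from the nearest on. -/
def leftOf {α : Type*} (z : ℤ → α) (x : ℤ) (n : ℕ) : α := z (x - 1 - n)

/-- The sites to the right of `x`, from the nearest on. -/
def rightOf {α : Type*} (z : ℤ → α) (x : ℤ) (n : ℕ) : α := z (x + 1 + n)

lemma leftOf_zero {α : Type*} (z : ℤ → α) (x : ℤ) : leftOf z x 0 = z (x - 1) := by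
  simp [leftOf]

lemma rightOf_zero {α : Type*} (z : ℤ → α) (x : ℤ) : rightOf z x 0 = z (x + 1) := by
  simp [rightOf]

lemma leftOf_succ {α : Type*} (z : ℤ → α) (x : ℤ) :
    (fun k => leftOf z x (k + 1)) = leftOf z (x - 1) := by
  funext k
  simp only [leftOf]
  congr 1
  push_cast
  ring

lemma rightOf_succ {α : Type*} (z : ℤ → α) (x : ℤ) :
    (fun k => rightOf z x (k + 1)) = rightOf z (x + 1) := by
  funext k
  simp only [rightOf]
  congr 1
  push_cast
  ring

/-- At the first ring of `x` both neighbours disagree with `x`. Here `z` lists the initial opinions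
and the first ring times. -/
def Flips (z : ℤ → Bool × ℝ) (x : ℤ) : Prop :=
  Opposed (z x).1 (z x).2 (leftOf z x) ∧ Opposed (z x).1 (z x).2 (rightOf z x)

open Classical in
/-- Majority dynamics on the integers: a site may change its opinion only at its first ring. -/
def majorityPath (z : ℤ → Bool × ℝ) (t : ℝ≥0) (x : ℤ) : Bool :=
  if (z x).2 ≤ t ∧ Flips z x then !(z x).1 else (z x).1

/-- Conditions on the first ring times under which `majorityPath` is majority dynamics. -/
structure GoodTimes (z : ℤ → Bool × ℝ) : Prop where
  left : ∀ x, LateTimes (leftOf z x)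
  right : ∀ x, LateTimes (rightOf z x)
  ne : ∀ x, (z x).2 ≠ (z (x + 1)).2

variable {z : ℤ → Bool × ℝ}

lemma GoodTimes.opposed_left_iff (h : GoodTimes z) (x : ℤ) (c : Bool) (s : ℝ) :
    Opposed c s (leftOf z x) ↔ (z (x - 1)).1 ≠ c ∧
      ¬ ((z (x - 1)).2 < s ∧ Opposed (z (x - 1)).1 (z (x - 1)).2 (leftOf z (x - 1))) := by
  rw [(h.left x).opposed_iff, leftOf_succ, leftOf_zero]

lemma GoodTimes.opposed_right_iff (h : GoodTimes z) (x : ℤ) (c : Bool) (s : ℝ) :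
    Opposed c s (rightOf z x) ↔ (z (x + 1)).1 ≠ c ∧
      ¬ ((z (x + 1)).2 < s ∧ Opposed (z (x + 1)).1 (z (x + 1)).2 (rightOf z (x + 1))) := by
  rw [(h.right x).opposed_iff, rightOf_succ, rightOf_zero]

/-- If `x - 1` rings before `x` and disagrees with it initially, then `x` still opposes it at that
ring. The right-hand condition in `Flips z (x - 1)` is then automatic, and the one-sided condition
is equivalent to flipping. -/
lemma GoodTimes.opposed_left_iff_flips (h : GoodTimes z) (x : ℤ) :
    Opposed (z x).1 (z x).2 (leftOf z x) ↔
      (z (x - 1)).1 ≠ (z x).1 ∧ ¬ ((z (x - 1)).2 < (z x).2 ∧ Flips z (x - 1)) := by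
  rw [h.opposed_left_iff]
  refine and_congr_right fun hne => not_congr (and_congr_right fun hlt => ?_)
  rw [Flips, h.opposed_right_iff, sub_add_cancel]
  exact ⟨fun ho => ⟨ho, hne.symm, fun h' => absurd h'.1 (not_lt.2 hlt.le)⟩, fun ho => ho.1⟩

lemma GoodTimes.opposed_right_iff_flips (h : GoodTimes z) (x : ℤ) :
    Opposed (z x).1 (z x).2 (rightOf z x) ↔
      (z (x + 1)).1 ≠ (z x).1 ∧ ¬ ((z (x + 1)).2 < (z x).2 ∧ Flips z (x + 1)) := by
  rw [h.opposed_right_iff]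
  refine and_congr_right fun hne => not_congr (and_congr_right fun hlt => ?_)
  rw [Flips, h.opposed_left_iff, add_sub_cancel_right]
  exact ⟨fun ho => ⟨⟨hne.symm, fun h' => absurd h'.1 (not_lt.2 hlt.le)⟩, ho⟩, fun ho => ho.2⟩

/-- A site flips if both neighbours disagree with it initially and do not flip before it. -/
lemma GoodTimes.flips_iff (h : GoodTimes z) (x : ℤ) :
    Flips z x ↔ ∀ y, y = x - 1 ∨ y = x + 1 →
      (z y).1 ≠ (z x).1 ∧ ¬ ((z y).2 < (z x).2 ∧ Flips z y) := by
  conv_lhs => rw [Flips, h.opposed_left_iff_flips, h.opposed_right_iff_flips]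
  constructor
  · rintro ⟨h1, h2⟩ y (rfl | rfl) <;> assumption
  · exact fun h' => ⟨h' _ (Or.inl rfl), h' _ (Or.inr rfl)⟩

lemma GoodTimes.ne_neighbour (h : GoodTimes z) {x y : ℤ} (hy : y = x - 1 ∨ y = x + 1) :
    (z y).2 ≠ (z x).2 := by
  rcases hy with rfl | rfl
  · simpa using h.ne (x - 1)
  · exact (h.ne x).symm

/-- The opinion of a site at times slightly before `r`. -/
lemma eventually_majorityPath (z : ℤ → Bool × ℝ) {r : ℝ≥0} (hr : 0 < r) (y : ℤ) :
    ∀ᶠ u in 𝓝[<] r, ((z y).2 < r ∧ Flips z y → majorityPath z u y = !(z y).1) ∧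
      (¬ ((z y).2 < r ∧ Flips z y) → majorityPath z u y = (z y).1) := by
  by_cases h : (z y).2 < r
  · have hlt : (z y).2.toNNReal < r := by
      rwa [← Real.toNNReal_coe (r := r), Real.toNNReal_lt_toNNReal_iff (by exact_mod_cast hr)]
    filter_upwards [eventually_Ico_nhdsLT hlt] with u hu
    have hle : (z y).2 ≤ u := Real.toNNReal_le_iff_le_coe.1 hu.1
    by_cases hf : Flips z y <;> simp [majorityPath, h, hle, hf]
  · filter_upwards [self_mem_nhdsWithin] with u hu
    have hle : ¬ (z y).2 ≤ u := not_le.2 (lt_of_lt_of_le hu (not_lt.1 h))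
    simp [majorityPath, h, hle]

/-- At the first ring the rule reduces to `GoodTimes.flips_iff`. At later rings some neighbour
agrees with `x`, which blocks any change. -/
lemma GoodTimes.isTrajectory_majorityPath (h : GoodTimes z) {R : ℤ → Set ℝ≥0}
    (hR0 : ∀ x, 0 ∉ R x) (hR : ∀ x, IsLeast ((fun r : ℝ≥0 => (r : ℝ)) '' R x) (z x).2) :
    IsTrajectory (majorityRule intLine) R (fun x => (z x).1) (majorityPath z) where
  initial := by
    funext x
    obtain ⟨r, hr, hrx⟩ := (hR x).1
    have h0 : ¬ (z x).2 ≤ ((0 : ℝ≥0) : ℝ) := by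
      rw [← hrx]
      simp only [NNReal.coe_le_coe, nonpos_iff_eq_zero]
      rintro rfl
      exact hR0 x hr
    rw [majorityPath, if_neg fun h' => h0 h'.1]
  const x s t hst hno := by
    have : (z x).2 ≤ t ↔ (z x).2 ≤ s := by
      obtain ⟨r, hr, hrx⟩ := (hR x).1
      rw [← hrx]
      simp only [NNReal.coe_le_coe]
      exact ⟨fun hrt => not_lt.1 fun hlt => hno r hr ⟨hlt, hrt⟩, fun hrs => hrs.trans hst⟩
    classical
    rw [majorityPath, majorityPath]
    exact if_congr (and_congr_left' this) rfl rfl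
  update x r hr := by
    have hr0 : 0 < r := pos_iff_ne_zero.2 fun h0 => hR0 x (h0 ▸ hr)
    have hTr : (z x).2 ≤ r := (hR x).2 ⟨r, hr, rfl⟩
    filter_upwards [eventually_majorityPath z hr0 x, eventually_majorityPath z hr0 (x - 1),
      eventually_majorityPath z hr0 (x + 1)] with u hx hl hrt
    rw [majorityRule_intLine]
    have hnb : ∀ y, y = x - 1 ∨ y = x + 1 →
        ((z y).2 < r ∧ Flips z y → majorityPath z u y = !(z y).1) ∧
        (¬ ((z y).2 < r ∧ Flips z y) → majorityPath z u y = (z y).1) := by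
      rintro y (rfl | rfl) <;> assumption
    have hfl : ∀ y, y = x - 1 ∨ y = x + 1 → Flips z y → (z y).1 ≠ (z x).1 := by
      intro y hy hf
      refine (((h.flips_iff y).1 hf) x ?_).1.symm
      omega
    rcases hTr.lt_or_eq with hlt | heq
    · -- a later ring changes nothing
      suffices hs : ∃ y, (y = x - 1 ∨ y = x + 1) ∧ majorityPath z u y = majorityPath z u x by
        have hkeep : majorityPath z r x = majorityPath z u x := by
          by_cases hf : Flips z x
          · rw [hx.1 ⟨hlt, hf⟩, majorityPath, if_pos ⟨hTr, hf⟩]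
          · rw [hx.2 (fun h' => hf h'.2), majorityPath, if_neg (fun h' => hf h'.2)]
        rw [if_neg, hkeep]
        rintro ⟨h1, h2⟩
        obtain ⟨y, rfl | rfl, hy⟩ := hs
        · exact h1 hy
        · exact h2 hy
      -- If `x` flips, the neighbour `x - 1` never does: whichever of the two rang first would have
      -- made them agree and blocked the other. So `x` has adopted the permanent opinion of `x - 1`.
      by_cases hf : Flips z x
      · have h1 := (h.flips_iff x).1 hf (x - 1) (Or.inl rfl)
        refine ⟨x - 1, Or.inl rfl, ?_⟩
        have hnf : ¬ Flips z (x - 1) := by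
          intro hf'
          have h2 := (h.flips_iff (x - 1)).1 hf' x (Or.inr (by omega))
          rcases lt_or_gt_of_ne (h.ne_neighbour (Or.inl rfl : x - 1 = x - 1 ∨ x - 1 = x + 1))
            with hl' | hl'
          · exact h1.2 ⟨hl', hf'⟩
          · exact h2.2 ⟨hl', hf⟩
        rw [hl.2 fun h' => hnf h'.2, hx.1 ⟨hlt, hf⟩]
        exact Bool.eq_not_of_ne h1.1
      -- If `x` does not flip, some neighbour either agreed with it from the start, and then never
      -- flips, or flipped to its opinion before its first ring.
      · rw [hx.2 fun h' => hf h'.2]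
        rw [h.flips_iff] at hf
        push Not at hf
        obtain ⟨y, hy, hf⟩ := hf
        refine ⟨y, hy, ?_⟩
        by_cases hne : (z y).1 = (z x).1
        · rw [(hnb y hy).2 fun h' => hfl y hy h'.2 hne, hne]
        · obtain ⟨hlt', hf'⟩ := hf hne
          rw [(hnb y hy).1 ⟨hlt'.trans hlt, hf'⟩]
          exact (Bool.eq_not_of_ne (Ne.symm hne)).symm
    · -- the first ring
      rw [hx.2 fun h' => absurd h'.1 (by rw [heq]; exact lt_irrefl _)]
      have hiff : ∀ y, y = x - 1 ∨ y = x + 1 → (majorityPath z u y ≠ (z x).1 ↔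
          (z y).1 ≠ (z x).1 ∧ ¬ ((z y).2 < (z x).2 ∧ Flips z y)) := by
        intro y hy
        rw [heq]
        by_cases hc : (z y).2 < r ∧ Flips z y
        · have h3 := hfl y hy hc.2
          rw [(hnb y hy).1 hc]
          simp only [hc, not_true_eq_false, and_false, iff_false, not_not, and_self]
          exact (Bool.eq_not_of_ne h3.symm).symm
        · rw [(hnb y hy).2 hc]
          simp only [hc, not_false_eq_true, and_true]
      classical
      rw [majorityPath]
      refine if_congr ?_ rfl rfl
      rw [hiff _ (Or.inl rfl), hiff _ (Or.inr rfl), h.flips_iff]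
      constructor
      · exact fun h' => ⟨h'.2 _ (Or.inl rfl), h'.2 _ (Or.inr rfl)⟩
      · rintro ⟨h1, h2⟩
        refine ⟨hTr, ?_⟩
        rintro y (rfl | rfl) <;> assumption

end Explicit


/-! ### Splitting infinite products of probability measures -/

section Products

open Measure

variable {α β ι A B : Type*} [MeasurableSpace A] [MeasurableSpace B]

/-- The product of two infinite products is determined by its values on boxes. -/
lemma prod_infinitePi_eq {μ : Measure A} {ν : Measure B} [IsProbabilityMeasure μ]
    [IsProbabilityMeasure ν] {ρ : Measure ((α → A) × (β → B))}
    (h : ∀ (s : Finset α) (t : α → Set A) (s' : Finset β) (t' : β → Set B),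
      (∀ i, MeasurableSet (t i)) → (∀ i, MeasurableSet (t' i)) →
      ρ ((s : Set α).pi t ×ˢ (s' : Set β).pi t') = (∏ i ∈ s, μ (t i)) * ∏ i ∈ s', ν (t' i)) :
    (infinitePi fun _ : α => μ).prod (infinitePi fun _ : β => ν) = ρ := by
  refine prod_eq_generateFrom generateFrom_squareCylinders generateFrom_squareCylinders
    (isPiSystem_squareCylinders (fun _ => MeasurableSpace.isPiSystem_measurableSet)
      fun _ => MeasurableSet.univ)
    (isPiSystem_squareCylinders (fun _ => MeasurableSpace.isPiSystem_measurableSet)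
      fun _ => MeasurableSet.univ)
    ⟨fun _ => Set.univ, fun _ => ⟨∅, fun _ => Set.univ, fun _ _ => .univ, by simp⟩,
      fun _ => measure_lt_top _ _, Set.iUnion_const _⟩
    ⟨fun _ => Set.univ, fun _ => ⟨∅, fun _ => Set.univ, fun _ _ => .univ, by simp⟩,
      fun _ => measure_lt_top _ _, Set.iUnion_const _⟩ ?_
  rintro _ ⟨s, t, ht, rfl⟩ _ ⟨s', t', ht', rfl⟩
  have ht : ∀ i, MeasurableSet (t i) := fun i => ht i trivial
  have ht' : ∀ i, MeasurableSet (t' i) := fun i => ht' i trivial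
  rw [h s t s' t' ht ht', infinitePi_pi _ fun i _ => ht i, infinitePi_pi _ fun i _ => ht' i]

/-- A sequence of independent pairs with independent components. -/
lemma infinitePi_prod_map (μ : Measure A) (ν : Measure B) [IsProbabilityMeasure μ]
    [IsProbabilityMeasure ν] :
    (infinitePi fun _ : ι => μ.prod ν).map (fun z => (fun i => (z i).1, fun i => (z i).2)) =
      (infinitePi fun _ : ι => μ).prod (infinitePi fun _ : ι => ν) := by
  symm
  refine prod_infinitePi_eq fun s t s' t' ht ht' => ?_
  classical
  -- Both boxes are padded by `Set.univ` to the common index set `s ∪ s'`, where their product is a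
  -- single box of pairs.
  have hm : ∀ i, MeasurableSet (if i ∈ s then t i else Set.univ) := fun i => by
    split_ifs
    exacts [ht i, .univ]
  have hm' : ∀ i, MeasurableSet (if i ∈ s' then t' i else Set.univ) := fun i => by
    split_ifs
    exacts [ht' i, .univ]
  have hpre : (fun z : ι → A × B => (fun i => (z i).1, fun i => (z i).2)) ⁻¹'
      ((s : Set ι).pi t ×ˢ (s' : Set ι).pi t') =
      ((s ∪ s' : Finset ι) : Set ι).pi fun i =>
        (if i ∈ s then t i else Set.univ) ×ˢ (if i ∈ s' then t' i else Set.univ) := by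
    ext z
    simp only [Set.mem_preimage, Set.mem_prod, Set.mem_pi, Finset.coe_union, Set.mem_union,
      Finset.mem_coe]
    constructor
    · rintro ⟨h1, h2⟩ i -
      refine ⟨?_, ?_⟩
      · split_ifs with hi
        exacts [h1 i hi, trivial]
      · split_ifs with hi
        exacts [h2 i hi, trivial]
    · intro h
      refine ⟨fun i hi => ?_, fun i hi => ?_⟩
      · simpa [hi] using (h i (Or.inl hi)).1
      · simpa [hi] using (h i (Or.inr hi)).2
  rw [map_apply (by fun_prop) (.prod (.pi s.countable_toSet fun i _ => ht i)
    (.pi s'.countable_toSet fun i _ => ht' i)), hpre,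
    infinitePi_pi _ fun i _ => (hm i).prod (hm' i)]
  simp only [prod_prod, Finset.prod_mul_distrib]
  congr 1
  · rw [← Finset.prod_subset (Finset.subset_union_left (s₁ := s) (s₂ := s'))
      fun i _ hi => by simp [hi]]
    exact Finset.prod_congr rfl fun i hi => by simp [hi]
  · rw [← Finset.prod_subset (Finset.subset_union_right (s₁ := s) (s₂ := s'))
      fun i _ hi => by simp [hi]]
    exact Finset.prod_congr rfl fun i hi => by simp [hi]

/-- Disjoint subfamilies of an i.i.d. family are independent. -/
lemma infinitePi_map_disjoint (μ : Measure A) [IsProbabilityMeasure μ] {f : α → ι} {g : β → ι}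
    (hf : f.Injective) (hg : g.Injective) (hfg : ∀ a b, f a ≠ g b) :
    (infinitePi fun _ : ι => μ).map (fun z => (fun a => z (f a), fun b => z (g b))) =
      (infinitePi fun _ : α => μ).prod (infinitePi fun _ : β => μ) := by
  symm
  refine prod_infinitePi_eq fun s t s' t' ht ht' => ?_
  have hinj := hf.sumElim hg hfg
  have hmap := map_infinitePi_infinitePi_of_inj (P := fun _ : ι => μ) hinj
  have hcomp : (infinitePi fun _ : ι => μ).map (fun z => (fun a => z (f a), fun b => z (g b))) =
      (infinitePi fun _ : α ⊕ β => μ).map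
        (fun z => (fun a => z (Sum.inl a), fun b => z (Sum.inr b))) := by
    rw [← hmap, map_map (by fun_prop) (by fun_prop)]
    rfl
  have hpre : (fun z : α ⊕ β → A => (fun a => z (Sum.inl a), fun b => z (Sum.inr b))) ⁻¹'
      ((s : Set α).pi t ×ˢ (s' : Set β).pi t') =
      ((s.disjSum s' : Finset (α ⊕ β)) : Set (α ⊕ β)).pi (Sum.elim t t') := by
    ext z
    simp [Set.mem_pi]
  rw [hcomp, map_apply (by fun_prop) (.prod (.pi s.countable_toSet fun i _ => ht i)
    (.pi s'.countable_toSet fun i _ => ht' i)), hpre, infinitePi_pi, Finset.prod_disjSum]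
  · simp
  · rintro (i | i) -
    exacts [ht i, ht' i]

/-- Separating one member of an i.i.d. family. -/
lemma infinitePi_map_insert (μ : Measure A) [IsProbabilityMeasure μ] (i : ι) {g : β → ι}
    (hg : g.Injective) (hi : ∀ b, i ≠ g b) :
    (infinitePi fun _ : ι => μ).map (fun z => (z i, fun b => z (g b))) =
      μ.prod (infinitePi fun _ : β => μ) := by
  have h := infinitePi_map_disjoint μ (f := fun _ : Unit => i) (fun _ _ _ => rfl) hg
    (fun _ b => hi b)
  calc _ = ((infinitePi fun _ : ι => μ).map
          (fun z => (fun _ : Unit => z i, fun b => z (g b)))).map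
          (Prod.map (fun y : Unit → A => y ()) id) := by
        rw [map_map (by fun_prop) (by fun_prop)]
        rfl
    _ = _ := by
        rw [h, ← map_prod_map _ _ (by fun_prop) (by fun_prop), infinitePi_map_eval, Measure.map_id]

/-- An event of positive probability occurs for some member of an infinite i.i.d. family. -/
lemma ae_infinitePi_exists_mem (μ : Measure A) [IsProbabilityMeasure μ] {e : ℕ → ι}
    (he : e.Injective) {D : Set A} (hD : MeasurableSet D) (h0 : μ D ≠ 0) :
    ∀ᵐ z ∂(infinitePi fun _ : ι => μ), ∃ n, z (e n) ∈ D := by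
  -- Bound by the event that the first `n` listed members all avoid `D`.
  have hle : ∀ n : ℕ, (infinitePi fun _ : ι => μ) {z | ¬ ∃ n, z (e n) ∈ D} ≤ (μ Dᶜ) ^ n := by
    intro n
    calc _ ≤ (infinitePi fun _ : ι => μ)
          ((((Finset.range n).map ⟨e, he⟩ : Finset ι) : Set ι).pi fun _ => Dᶜ) := by
          refine measure_mono fun z hz i hi => ?_
          simp only [Finset.coe_map, Set.mem_image] at hi
          obtain ⟨m, -, rfl⟩ := hi
          exact fun hzm => hz ⟨m, hzm⟩
      _ = _ := by
          rw [infinitePi_pi _ fun i _ => hD.compl]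
          simp
  have hlt : μ Dᶜ < 1 := by
    rw [prob_compl_eq_one_sub hD]
    exact ENNReal.sub_lt_self ENNReal.one_ne_top one_ne_zero h0
  exact le_antisymm (ge_of_tendsto' (ENNReal.tendsto_pow_atTop_nhds_zero_of_lt_one hlt) hle)
    zero_le

end Products

/-! ### The clocks -/

section Clocks

open ProbabilityTheory Measure

instance : IsProbabilityMeasure (expMeasure 1) := isProbabilityMeasure_expMeasure one_pos

lemma expMeasure_eq_withDensity : expMeasure 1 = volume.withDensity (exponentialPDF 1) := rfl

instance : NullSingletonClass (expMeasure 1) := by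
  rw [expMeasure_eq_withDensity]
  infer_instance

lemma expMeasure_real_Iic {T : ℝ} (hT : 0 ≤ T) : (expMeasure 1).real (Set.Iic T) =
    1 - Real.exp (-T) := by
  rw [← cdf_eq_real, cdf_expMeasure_eq one_pos, if_pos hT, one_mul]

lemma expMeasure_Ioi_ne_zero (T : ℝ) : expMeasure 1 (Set.Ioi T) ≠ 0 := by
  intro h
  have h1 : expMeasure 1 (Set.Ioi (max T 0)) = 0 :=
    measure_mono_null (Set.Ioi_subset_Ioi (le_max_left _ _)) h
  have h2 := expMeasure_real_Iic (le_max_right T 0)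
  rw [← Set.compl_Ioi, probReal_compl_eq_one_sub measurableSet_Ioi, measureReal_def, h1] at h2
  have := Real.exp_pos (-max T 0)
  simp at h2
  linarith

lemma ae_expMeasure_pos : ∀ᵐ s ∂(expMeasure 1), 0 < s := by
  have h : (expMeasure 1).real (Set.Iic 0) = 0 := by
    rw [expMeasure_real_Iic le_rfl]
    simp
  rw [ae_iff]
  simpa [measureReal_eq_zero_iff, Set.Iic] using h

/-- The waiting times at all sites. -/
abbrev gapLaw : Measure (ℤ → ℕ → ℝ) :=
  infinitePi fun _ : ℤ => infinitePi fun _ : ℕ => expMeasure 1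

/-- Properties that waiting times of independent Poisson clocks have almost surely. -/
structure GoodGaps (gap : ℤ → ℕ → ℝ) : Prop where
  pos : ∀ x n, 0 < gap x n
  -- Infinitely many waiting times exceed one, so the ring times of a clock cannot accumulate.
  long : ∀ x (m : ℕ), ∃ n, 1 < gap x (m + n)
  right : ∀ (x : ℤ) (T : ℕ), ∃ n : ℕ, (T : ℝ) < gap (x + 1 + n) 0
  left : ∀ (x : ℤ) (T : ℕ), ∃ n : ℕ, (T : ℝ) < gap (x - 1 - n) 0
  ne : ∀ x, gap x 0 ≠ gap (x + 1) 0

lemma ae_prod_ne (μ ν : Measure ℝ) [SFinite μ] [SFinite ν] [NullSingletonClass ν] :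
    ∀ᵐ q ∂(μ.prod ν), q.1 ≠ q.2 := by
  refine (ae_prod_iff_ae_ae ?_).2 (.of_forall fun a => ?_)
  · exact (measurableSet_eq_fun measurable_fst measurable_snd).compl
  · filter_upwards [compl_mem_ae_iff.2 (measure_singleton (μ := ν) a)] with b hb
    exact fun h => hb h.symm

/-- Long gaps and late first rings come from `ae_infinitePi_exists_mem`, since the exponential law
charges every half-line `(T, ∞)`; neighbouring first rings differ because that law has no atoms. -/
lemma ae_goodGaps : ∀ᵐ gap ∂gapLaw, GoodGaps gap := by
  have heval : ∀ x : ℤ, ∀ {p : (ℕ → ℝ) → Prop},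
      (∀ᵐ g ∂(infinitePi fun _ : ℕ => expMeasure 1), p g) → ∀ᵐ gap ∂gapLaw, p (gap x) :=
    fun x p h => (measurePreserving_eval_infinitePi
      (fun _ : ℤ => infinitePi fun _ : ℕ => expMeasure 1) x).quasiMeasurePreserving.ae h
  have hlate : ∀ T : ℝ, MeasurableSet {g : ℕ → ℝ | T < g 0} := fun T =>
    measurableSet_lt measurable_const (measurable_pi_apply 0)
  have hlate0 : ∀ T : ℝ, (infinitePi fun _ : ℕ => expMeasure 1) {g : ℕ → ℝ | T < g 0} ≠ 0 := by
    intro T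
    have := (measurePreserving_eval_infinitePi (fun _ : ℕ => expMeasure 1) 0).measure_preimage
      (s := Set.Ioi T) measurableSet_Ioi.nullMeasurableSet
    exact this ▸ expMeasure_Ioi_ne_zero T
  have h1 : ∀ᵐ gap ∂gapLaw, ∀ x n, 0 < gap x n := by
    simp only [ae_all_iff]
    exact fun x n => heval x (p := fun g => 0 < g n) ((measurePreserving_eval_infinitePi
      (fun _ : ℕ => expMeasure 1) n).quasiMeasurePreserving.ae ae_expMeasure_pos)
  have h2 : ∀ᵐ gap ∂gapLaw, ∀ x (m : ℕ), ∃ n, 1 < gap x (m + n) := by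
    simp only [ae_all_iff]
    exact fun x m => heval x (p := fun g => ∃ n, 1 < g (m + n)) (ae_infinitePi_exists_mem _
      (e := fun n => m + n) (add_right_injective m) measurableSet_Ioi (expMeasure_Ioi_ne_zero 1))
  have h3 : ∀ᵐ gap ∂gapLaw, ∀ (x : ℤ) (T : ℕ), ∃ n : ℕ, (T : ℝ) < gap (x + 1 + n) 0 := by
    simp only [ae_all_iff]
    exact fun x T => ae_infinitePi_exists_mem _ (e := fun n : ℕ => x + 1 + (n : ℤ))
      (fun a b h => by simpa using h) (hlate T) (hlate0 T)
  have h4 : ∀ᵐ gap ∂gapLaw, ∀ (x : ℤ) (T : ℕ), ∃ n : ℕ, (T : ℝ) < gap (x - 1 - n) 0 := by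
    simp only [ae_all_iff]
    exact fun x T => ae_infinitePi_exists_mem _ (e := fun n : ℕ => x - 1 - (n : ℤ))
      (fun a b h => by simpa using h) (hlate T) (hlate0 T)
  have h5 : ∀ᵐ gap ∂gapLaw, ∀ x, gap x 0 ≠ gap (x + 1) 0 := by
    rw [ae_all_iff]
    intro x
    have hmap : gapLaw.map (fun gap => (gap x 0, gap (x + 1) 0)) =
        (expMeasure 1).prod (expMeasure 1) := by
      have : (fun gap : ℤ → ℕ → ℝ => (gap x 0, gap (x + 1) 0)) =
          Prod.map (fun g : ℕ → ℝ => g 0) (fun g : ℕ → ℝ => g 0) ∘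
            fun gap => (gap x, gap (x + 1)) := rfl
      rw [this, ← map_map (by fun_prop) (by fun_prop),
        infinitePi_map_eval_prod (show x ≠ x + 1 by omega),
        ← map_prod_map _ _ (by fun_prop) (by fun_prop), infinitePi_map_eval]
    have h := ae_prod_ne (expMeasure 1) (expMeasure 1)
    rw [← hmap] at h
    exact ae_of_ae_map (f := fun gap : ℤ → ℕ → ℝ => (gap x 0, gap (x + 1) 0)) (by fun_prop) h
  filter_upwards [h1, h2, h3, h4, h5] with gap a b c d e
  exact ⟨a, b, c, d, e⟩

namespace GoodGaps

variable {gap : ℤ → ℕ → ℝ}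

lemma strictMono_sum (h : GoodGaps gap) (x : ℤ) :
    StrictMono fun n => ∑ i ∈ Finset.range n, gap x i :=
  strictMono_nat_of_lt_succ fun n => by
    rw [Finset.sum_range_succ]
    exact lt_add_of_pos_right _ (h.pos x n)

lemma exists_lt_sum (h : GoodGaps gap) (x : ℤ) (m : ℕ) :
    ∃ n, (m : ℝ) ≤ ∑ i ∈ Finset.range n, gap x i := by
  induction m with
  | zero => exact ⟨0, by simp⟩
  | succ m ih =>
    obtain ⟨n, hn⟩ := ih
    obtain ⟨k, hk⟩ := h.long x n
    refine ⟨n + k + 1, ?_⟩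
    have := (h.strictMono_sum x).monotone (Nat.le_add_right n k)
    rw [Finset.sum_range_succ]
    push_cast
    linarith

lemma gap_le (h : GoodGaps gap) (x : ℤ) {r : ℝ≥0} (hr : r ∈ rings gap x) : gap x 0 ≤ r := by
  obtain ⟨n, hn⟩ := hr
  have := (h.strictMono_sum x).monotone (show 1 ≤ n + 1 by omega)
  rw [hn]
  simpa using this

lemma isLeast (h : GoodGaps gap) (x : ℤ) :
    IsLeast ((fun r : ℝ≥0 => (r : ℝ)) '' rings gap x) (gap x 0) := by
  refine ⟨⟨⟨gap x 0, (h.pos x 0).le⟩, ⟨0, (Finset.sum_range_one _).symm⟩, rfl⟩, ?_⟩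
  rintro _ ⟨r, hr, rfl⟩
  exact h.gap_le x hr

lemma rings_inter_Iic_eq_empty (h : GoodGaps gap) {x : ℤ} {T : ℝ≥0} (hT : (T : ℝ) < gap x 0) :
    rings gap x ∩ Set.Iic T = ∅ :=
  Set.eq_empty_iff_forall_notMem.2 fun _ hr =>
    absurd (h.gap_le x hr.1) (not_le.2 (lt_of_le_of_lt (NNReal.coe_le_coe.2 hr.2) hT))

lemma wellSpaced (h : GoodGaps gap) : WellSpaced (rings gap) where
  pos x h0 := absurd (h.gap_le x h0) (not_le.2 (h.pos x 0))
  finite x T := by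
    obtain ⟨m, hm⟩ := exists_nat_gt (T : ℝ)
    obtain ⟨N, hN⟩ := h.exists_lt_sum x m
    refine ((Set.finite_Iio N).image
      fun n => (∑ i ∈ Finset.range (n + 1), gap x i).toNNReal).subset ?_
    rintro r ⟨⟨n, hn⟩, hr⟩
    refine ⟨n, ?_, ?_⟩
    · by_contra hlt
      have h1 := (h.strictMono_sum x).monotone (show N ≤ n + 1 by simp at hlt; omega)
      have h2 : (r : ℝ) ≤ T := NNReal.coe_le_coe.2 hr
      linarith
    · simp only
      rw [← hn, Real.toNNReal_coe]
  quiet_right x T := by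
    obtain ⟨m, hm⟩ := exists_nat_gt (T : ℝ)
    obtain ⟨n, hn⟩ := h.right x m
    exact ⟨x + 1 + n, by omega, h.rings_inter_Iic_eq_empty (hm.trans hn)⟩
  quiet_left x T := by
    obtain ⟨m, hm⟩ := exists_nat_gt (T : ℝ)
    obtain ⟨n, hn⟩ := h.left x m
    exact ⟨x - 1 - n, by omega, h.rings_inter_Iic_eq_empty (hm.trans hn)⟩

lemma goodTimes (h : GoodGaps gap) (ξ : ℤ → Bool) : GoodTimes fun x => (ξ x, gap x 0) where
  right x m T := by
    -- The search starts `m` sites further out, which forces the index found to be at least `m`.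
    obtain ⟨k, hk⟩ := exists_nat_gt T
    obtain ⟨n, hn⟩ := h.right (x + m) k
    refine ⟨m + n, by omega, ?_⟩
    simp only [rightOf]
    rw [show x + 1 + ((m + n : ℕ) : ℤ) = x + m + 1 + n by push_cast; ring]
    exact hk.trans hn
  left x m T := by
    obtain ⟨k, hk⟩ := exists_nat_gt T
    obtain ⟨n, hn⟩ := h.left (x - m) k
    refine ⟨m + n, by omega, ?_⟩
    simp only [leftOf]
    rw [show x - 1 - ((m + n : ℕ) : ℤ) = x - m - 1 - n by push_cast; ring]
    exact hk.trans hn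
  ne x := h.ne x

lemma evolution_majority (h : GoodGaps gap) (ξ : ℤ → Bool) :
    evolution (majorityRule intLine) (rings gap) ξ = majorityPath fun x => (ξ x, gap x 0) :=
  ((h.goodTimes ξ).isTrajectory_majorityPath h.wellSpaced.pos
    fun x => h.isLeast x).evolution_eq h.wellSpaced isLocal_majorityRule

end GoodGaps

lemma ae_graphicalLaw_goodGaps {S : Type*} [MeasurableSpace S] (ν : Measure S)
    [IsProbabilityMeasure ν] : ∀ᵐ ω ∂(graphicalLaw ℤ ν), GoodGaps ω.2 :=
  quasiMeasurePreserving_snd.ae ae_goodGaps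

/-- The initial opinions and the first ring times are i.i.d. -/
lemma graphicalLaw_map {S : Type*} [MeasurableSpace S] (ν : Measure S)
    [IsProbabilityMeasure ν] :
    (graphicalLaw ℤ ν).map (fun ω x => (ω.1 x, ω.2 x 0)) =
      infinitePi fun _ : ℤ => ν.prod (expMeasure 1) := by
  have h1 : (graphicalLaw ℤ ν).map (Prod.map id fun gap x => gap x 0) =
      (infinitePi fun _ : ℤ => ν).prod (infinitePi fun _ : ℤ => expMeasure 1) := by
    rw [graphicalLaw, ← map_prod_map _ _ (by fun_prop) (by fun_prop), Measure.map_id,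
      infinitePi_map_pi (fun _ : ℤ => infinitePi fun _ : ℕ => expMeasure 1)
        (f := fun _ g => g 0) (by fun_prop)]
    simp only [infinitePi_map_eval]
  have h2 : (fun (ω : (ℤ → S) × (ℤ → ℕ → ℝ)) x => (ω.1 x, ω.2 x 0)) =
      (fun q : (ℤ → S) × (ℤ → ℝ) => fun x => (q.1 x, q.2 x)) ∘
        Prod.map id fun gap x => gap x 0 := rfl
  rw [h2, ← map_map (by fun_prop) (by fun_prop), h1, ← infinitePi_prod_map,
    map_map (by fun_prop) (by fun_prop)]
  exact Measure.map_id

end Clocks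


/-! ### The law of the explicit form of majority dynamics -/

section Law

open ProbabilityTheory Measure

lemma prod_real_eq_integral {α β : Type*} [MeasurableSpace α] [MeasurableSpace β] (μ : Measure α)
    (ν : Measure β) [IsProbabilityMeasure ν] {s : Set (α × β)}
    (hs : MeasurableSet s) : (μ.prod ν).real s = ∫ x, ν.real (Prod.mk x ⁻¹' s) ∂μ := by
  rw [measureReal_def, prod_apply hs]
  exact (integral_toReal (measurable_measure_prodMk_left hs).aemeasurable
    (.of_forall fun _ => measure_lt_top _ _)).symm

lemma setIntegral_expMeasure {t : ℝ} (ht : 0 ≤ t) (f : ℝ → ℝ) :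
    ∫ u in Set.Iic t, f u ∂(expMeasure 1) = ∫ u in (0 : ℝ)..t, Real.exp (-u) * f u := by
  have h : expMeasure 1 = (volume.restrict (Set.Ici (0 : ℝ))).withDensity
      fun u => ENNReal.ofReal (Real.exp (-u)) := by
    rw [expMeasure_eq_withDensity, ← withDensity_indicator measurableSet_Ici]
    congr 1
    funext u
    rw [exponentialPDF_eq, Set.indicator_apply]
    by_cases hu : 0 ≤ u <;> simp [hu]
  rw [h, setIntegral_withDensity_eq_setIntegral_toReal_smul (by fun_prop)
    (.of_forall fun _ => ENNReal.ofReal_lt_top) _ measurableSet_Iic,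
    restrict_restrict measurableSet_Iic, intervalIntegral.integral_of_le ht,
    ← integral_Icc_eq_integral_Ioc]
  have : Set.Iic t ∩ Set.Ici 0 = Set.Icc 0 t := by
    ext u
    simp [and_comm]
  rw [this]
  simp [ENNReal.toReal_ofReal (Real.exp_pos _).le]

lemma measurable_opposedUpTo (n : ℕ) :
    Measurable fun q : (Bool × ℝ) × (ℕ → Bool × ℝ) => OpposedUpTo n q.1.1 q.1.2 q.2 := by
  induction n with
  | zero => exact measurable_const
  | succ n ih =>
    simp only [OpposedUpTo]
    refine .and (.not ?_) (.not (.and ?_ ?_))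
    · exact measurableSet_setOfPred.1 (measurableSet_eq_fun (by fun_prop) (by fun_prop))
    · exact measurableSet_setOfPred.1 (measurableSet_lt (by fun_prop) (by fun_prop))
    · exact ih.comp (g := fun q => OpposedUpTo n q.1.1 q.1.2 q.2)
        (f := fun q : (Bool × ℝ) × (ℕ → Bool × ℝ) => (q.2 0, fun k => q.2 (k + 1)))
        (by fun_prop)

lemma measurable_opposed :
    Measurable fun q : (Bool × ℝ) × (ℕ → Bool × ℝ) => Opposed q.1.1 q.1.2 q.2 := by
  simp only [Opposed, eventually_atTop]
  exact .exists fun N => .forall fun n => .imp measurable_const (measurable_opposedUpTo n)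

lemma measurableSet_opposed (b : Bool × ℝ) :
    MeasurableSet {z : ℕ → Bool × ℝ | Opposed b.1 b.2 z} :=
  measurableSet_setOfPred.2 (measurable_opposed.comp (measurable_prodMk_left (x := b)))

/-! ### One-sided disagreement probabilities -/

variable (ν : Measure Bool)

lemma integral_ite_eq (c : Bool) (d : ℝ) :
    ∫ b, (if b = c then d else 0) ∂ν = ν.real {c} * d := by
  have : (fun b => if b = c then d else 0) = Set.indicator {c} fun _ => d := by
    funext b
    simp [Set.indicator_apply]
  rw [this, integral_indicator_const _ (measurableSet_singleton c), smul_eq_mul]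

lemma integral_siteLaw (c : Bool) (g : ℝ → ℝ) :
    ∫ b, (if b.1 = c then 1 else 0) * g b.2 ∂(ν.prod (expMeasure 1)) =
      ν.real {c} * ∫ u, g u ∂(expMeasure 1) := by
  rw [integral_prod_mul (fun b => if b = c then (1 : ℝ) else 0) g, integral_ite_eq, mul_one]

/-- The law of the initial opinions and the first ring times on one side of a site. -/
abbrev sideLaw : Measure (ℕ → Bool × ℝ) := infinitePi fun _ : ℕ => ν.prod (expMeasure 1)

/-- The probability that the neighbour on one side disagrees just before time `s`. -/
def opposedProb (c : Bool) (s : ℝ) : ℝ := (sideLaw ν).real {z | Opposed c s z}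

lemma opposedProb_nonneg (c : Bool) (s : ℝ) : 0 ≤ opposedProb ν c s := measureReal_nonneg

variable [IsProbabilityMeasure ν]

lemma measurable_opposedProb (c : Bool) : Measurable (opposedProb ν c) := by
  have h := measurable_measure_prodMk_left (ν := sideLaw ν) (measurableSet_setOfPred.2 measurable_opposed)
  exact (h.comp (measurable_prodMk_left (x := c))).ennreal_toReal

lemma opposedProb_le_one (c : Bool) (s : ℝ) : opposedProb ν c s ≤ 1 := measureReal_le_one

lemma integrable_opposedProb (c : Bool) (μ : Measure ℝ) [IsFiniteMeasure μ] :
    Integrable (opposedProb ν c) μ :=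
  .of_bound (measurable_opposedProb ν c).aestronglyMeasurable 1 <| .of_forall fun s => by
    rw [Real.norm_of_nonneg (opposedProb_nonneg ν c s)]
    exact opposedProb_le_one ν c s

lemma integrable_opposedProb_sq (c : Bool) (μ : Measure ℝ) [IsFiniteMeasure μ] :
    Integrable (fun s => opposedProb ν c s ^ 2) μ :=
  .of_bound ((measurable_opposedProb ν c).pow_const 2).aestronglyMeasurable 1 <|
    .of_forall fun s => by
      rw [Real.norm_of_nonneg (sq_nonneg _)]
      exact pow_le_one₀ (opposedProb_nonneg ν c s) (opposedProb_le_one ν c s)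

lemma ae_lateTimes : ∀ᵐ z ∂(sideLaw ν), LateTimes z := by
  have hm : ∀ T : ℝ, MeasurableSet {b : Bool × ℝ | T < b.2} := fun T =>
    measurableSet_lt measurable_const measurable_snd
  have h0 : ∀ T : ℝ, (ν.prod (expMeasure 1)) {b : Bool × ℝ | T < b.2} ≠ 0 := by
    intro T
    have : {b : Bool × ℝ | T < b.2} = Set.univ ×ˢ Set.Ioi T := by
      ext b
      simp
    rw [this, prod_prod, measure_univ, one_mul]
    exact expMeasure_Ioi_ne_zero T
  have h : ∀ᵐ z ∂(sideLaw ν), ∀ m T : ℕ, ∃ n, (T : ℝ) < (z (m + n)).2 := by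
    simp only [ae_all_iff]
    exact fun m T => ae_infinitePi_exists_mem _ (e := fun n => m + n) (add_right_injective m)
      (hm T) (h0 T)
  filter_upwards [h] with z hz m T
  obtain ⟨k, hk⟩ := exists_nat_gt T
  obtain ⟨n, hn⟩ := hz m k
  exact ⟨m + n, by omega, hk.trans hn⟩

/-- Condition on the nearest site of the side. It must start with opinion `!c` and must not flip at
a time `u < s`; the sites beyond it are again distributed as `sideLaw`, so that flip has conditional
probability `opposedProb ν (!c) u`. -/
lemma opposedProb_eq (c : Bool) {s : ℝ} (hs : 0 ≤ s) :
    opposedProb ν c s =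
      ν.real {!c} * (1 - ∫ u in (0 : ℝ)..s, Real.exp (-u) * opposedProb ν (!c) u) := by
  let E : Set ((Bool × ℝ) × (ℕ → Bool × ℝ)) :=
    {q | q.1.1 ≠ c ∧ ¬ (q.1.2 < s ∧ Opposed q.1.1 q.1.2 q.2)}
  have hE : MeasurableSet E := by
    refine measurableSet_setOfPred.2 (.and (.not ?_) (.not (.and ?_ measurable_opposed)))
    · exact measurableSet_setOfPred.1 (measurableSet_eq_fun (by fun_prop) (by fun_prop))
    · exact measurableSet_setOfPred.1 (measurableSet_lt (by fun_prop) (by fun_prop))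
  have h1 : opposedProb ν c s = ((ν.prod (expMeasure 1)).prod (sideLaw ν)).real E := by
    rw [← infinitePi_map_insert (ν.prod (expMeasure 1)) 0 (g := fun n : ℕ => n + 1)
      (add_left_injective 1) (by omega), map_measureReal_apply (by fun_prop) hE]
    refine measureReal_congr ?_
    filter_upwards [ae_lateTimes ν] with z hz
    exact propext (hz.opposed_iff c s)
  rw [h1, prod_real_eq_integral _ _ hE]
  have h2 : ∀ b : Bool × ℝ, (sideLaw ν).real (Prod.mk b ⁻¹' E) =
      (if b.1 = !c then 1 else 0) *
        (1 - (Set.Iio s).indicator (opposedProb ν (!c)) b.2) := by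
    rintro ⟨b, u⟩
    by_cases hb : b = !c
    · subst hb
      by_cases hu : u < s
      · have : Prod.mk (!c, u) ⁻¹' E = {z | Opposed (!c) u z}ᶜ := by
          ext z
          simp [E, hu]
        rw [this, probReal_compl_eq_one_sub (measurableSet_opposed (!c, u))]
        simp [hu, opposedProb]
      · have : Prod.mk (!c, u) ⁻¹' E = Set.univ := by
          ext z
          simp [E, hu]
        simp [this, hu]
    · have : Prod.mk (b, u) ⁻¹' E = ∅ := by
        ext z
        simp only [Bool.eq_not] at hb
        simp [E, hb]
      simp [this, hb]
  simp only [h2]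
  rw [integral_siteLaw ν _ fun u => 1 - (Set.Iio s).indicator (opposedProb ν (!c)) u,
    integral_sub (integrable_const _)
    ((integrable_opposedProb ν _ _).indicator measurableSet_Iio),
    integral_indicator measurableSet_Iio, ← integral_Iic_eq_integral_Iio,
    setIntegral_expMeasure hs]
  simp

/-- A quantity conserved by a pair of coupled integral equations. -/
lemma conserved_of_integral_eq {f g : ℝ → ℝ} {α β : ℝ} (hf : Measurable f) (hg : Measurable g)
    (hf1 : ∀ s, ‖f s‖ ≤ 1) (hg1 : ∀ s, ‖g s‖ ≤ 1)
    (hfe : ∀ s, 0 ≤ s → f s = α * (1 - ∫ u in (0 : ℝ)..s, Real.exp (-u) * g u))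
    (hge : ∀ s, 0 ≤ s → g s = β * (1 - ∫ u in (0 : ℝ)..s, Real.exp (-u) * f u))
    {s : ℝ} (hs : 0 ≤ s) : β * f s ^ 2 - α * g s ^ 2 = β * α ^ 2 - α * β ^ 2 := by
  have hint : ∀ k : ℝ → ℝ, Measurable k → (∀ s, ‖k s‖ ≤ 1) → ∀ a b,
      IntervalIntegrable (fun u => Real.exp (-u) * k u) volume a b := by
    intro k hk hk1 a b
    rw [intervalIntegrable_iff]
    refine Integrable.mul_bdd (c := 1) ?_ hk.aestronglyMeasurable (.of_forall hk1)
    exact intervalIntegrable_iff.1 (Continuous.intervalIntegrable (by fun_prop) a b)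
  -- Bootstrap: a bounded measurable integrand makes the other function continuous, and continuity
  -- then gives differentiability. Only right derivatives are used, since the equations hold for `s
  -- ≥ 0` only.
  have hcont : ∀ {k l : ℝ → ℝ} {γ : ℝ}, Measurable l → (∀ s, ‖l s‖ ≤ 1) →
      (∀ s, 0 ≤ s → k s = γ * (1 - ∫ u in (0 : ℝ)..s, Real.exp (-u) * l u)) →
      ContinuousOn k (Set.Ici 0) := by
    intro k l γ hl hl1 hk
    refine ContinuousOn.congr ?_ fun s hs => hk s hs
    exact (continuous_const.mul (continuous_const.sub
      (intervalIntegral.continuous_primitive (hint l hl hl1) 0))).continuousOn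
  have hderiv : ∀ {k l : ℝ → ℝ} {γ : ℝ}, Measurable l → (∀ s, ‖l s‖ ≤ 1) →
      ContinuousOn l (Set.Ici 0) →
      (∀ s, 0 ≤ s → k s = γ * (1 - ∫ u in (0 : ℝ)..s, Real.exp (-u) * l u)) →
      ∀ u, 0 ≤ u → HasDerivWithinAt k (γ * -(Real.exp (-u) * l u)) (Set.Ici u) u := by
    intro k l γ hl hl1 hlc hk u hu
    have hm : Measurable fun v => Real.exp (-v) * l v := by fun_prop
    have hd := intervalIntegral.integral_hasDerivWithinAt_right (s := Set.Ici u) (t := Set.Ioi u)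
      (hint l hl hl1 0 u)
      hm.stronglyMeasurable.stronglyMeasurableAtFilter
      ((Continuous.continuousWithinAt (by fun_prop)).mul
        ((hlc u hu).mono (Set.Ioi_subset_Ici hu)))
    refine ((hd.const_sub 1).const_mul γ).congr (fun v hv => ?_) (hk u hu)
    exact hk v (le_trans hu hv)
  have hfc := hcont hg hg1 hfe
  have hgc := hcont hf hf1 hge
  have h := constant_of_has_deriv_right_zero (f := fun s => β * f s ^ 2 - α * g s ^ 2)
    (a := 0) (b := s) ?_ ?_ s ⟨hs, le_rfl⟩
  · rw [h, hfe 0 le_rfl, hge 0 le_rfl]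
    simp
  · exact ((continuousOn_const.mul (hfc.pow 2)).sub (continuousOn_const.mul (hgc.pow 2))).mono
      Set.Icc_subset_Ici_self
  · intro u hu
    have h1 := hderiv hg hg1 hgc hfe u hu.1
    have h2 := hderiv hf hf1 hfc hge u hu.1
    -- Both terms have derivative `-2αβ e^{-u} f g`, so the difference has derivative zero.
    refine (((h1.pow 2).const_mul β).sub ((h2.pow 2).const_mul α)).congr_deriv ?_
    push_cast
    ring

lemma opposedProb_conserved {s : ℝ} (hs : 0 ≤ s) :
    ν.real {true} * opposedProb ν true s ^ 2 - ν.real {false} * opposedProb ν false s ^ 2 =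
      ν.real {true} * ν.real {false} ^ 2 - ν.real {false} * ν.real {true} ^ 2 := by
  have hb : ∀ c s, ‖opposedProb ν c s‖ ≤ 1 := fun c s => by
    rw [Real.norm_of_nonneg (opposedProb_nonneg ν c s)]
    exact opposedProb_le_one ν c s
  exact conserved_of_integral_eq (measurable_opposedProb ν _) (measurable_opposedProb ν _)
    (hb _) (hb _) (fun s hs => opposedProb_eq ν true hs) (fun s hs => opposedProb_eq ν false hs) hs

/-- The opinion at time `t` of a site with initial opinion and first ring time `b`, with the two
sides of the site described by the second component. -/
def splitPath (t : ℝ≥0) (q : (Bool × ℝ) × ((ℕ → Bool × ℝ) × (ℕ → Bool × ℝ))) : Prop :=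
  (q.1.1 = true ∧ ¬ (q.1.2 ≤ t ∧ Opposed q.1.1 q.1.2 q.2.1 ∧ Opposed q.1.1 q.1.2 q.2.2)) ∨
  (q.1.1 = false ∧ (q.1.2 ≤ t ∧ Opposed q.1.1 q.1.2 q.2.1 ∧ Opposed q.1.1 q.1.2 q.2.2))

lemma majorityPath_eq_true_iff (z : ℤ → Bool × ℝ) (t : ℝ≥0) (x : ℤ) :
    majorityPath z t x = true ↔ splitPath t (z x, (leftOf z x, rightOf z x)) := by
  unfold majorityPath splitPath Flips
  cases h : (z x).1 <;> simp

lemma measurable_splitPath (t : ℝ≥0) : Measurable (splitPath t) := by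
  have h1 : Measurable fun q : (Bool × ℝ) × ((ℕ → Bool × ℝ) × (ℕ → Bool × ℝ)) =>
      Opposed q.1.1 q.1.2 q.2.1 :=
    measurable_opposed.comp
      (f := fun q : (Bool × ℝ) × ((ℕ → Bool × ℝ) × (ℕ → Bool × ℝ)) => (q.1, q.2.1))
      (by fun_prop)
  have h2 : Measurable fun q : (Bool × ℝ) × ((ℕ → Bool × ℝ) × (ℕ → Bool × ℝ)) =>
      Opposed q.1.1 q.1.2 q.2.2 :=
    measurable_opposed.comp
      (f := fun q : (Bool × ℝ) × ((ℕ → Bool × ℝ) × (ℕ → Bool × ℝ)) => (q.1, q.2.2))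
      (by fun_prop)
  have h3 : Measurable fun q : (Bool × ℝ) × ((ℕ → Bool × ℝ) × (ℕ → Bool × ℝ)) =>
      q.1.2 ≤ t := measurableSet_setOfPred.1 (measurableSet_le (by fun_prop) (by fun_prop))
  have h4 : ∀ c, Measurable fun q : (Bool × ℝ) × ((ℕ → Bool × ℝ) × (ℕ → Bool × ℝ)) =>
      q.1.1 = c := fun c =>
    measurableSet_setOfPred.1 (measurableSet_eq_fun (by fun_prop) (by fun_prop))
  exact .or (.and (h4 _) (.not (.and h3 (.and h1 h2)))) (.and (h4 _) (.and h3 (.and h1 h2)))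

lemma measurable_split (x : ℤ) :
    Measurable fun z : ℤ → Bool × ℝ => (z x, (leftOf z x, rightOf z x)) := by
  refine .prodMk (by fun_prop) (.prodMk ?_ ?_) <;> refine measurable_pi_lambda _ fun n => ?_
  · exact measurable_pi_apply (x - 1 - (n : ℤ))
  · exact measurable_pi_apply (x + 1 + (n : ℤ))

lemma measurableSet_majorityPath (t : ℝ≥0) (x : ℤ) :
    MeasurableSet {z | majorityPath z t x = true} := by
  simp only [majorityPath_eq_true_iff]
  exact measurableSet_setOfPred.2 ((measurable_splitPath t).comp (measurable_split x))

/-- A site and the sequences of sites to its left and to its right are independent. -/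
lemma map_split (x : ℤ) :
    (infinitePi fun _ : ℤ => ν.prod (expMeasure 1)).map
        (fun z => (z x, (leftOf z x, rightOf z x))) =
      (ν.prod (expMeasure 1)).prod ((sideLaw ν).prod (sideLaw ν)) := by
  let g : ℕ ⊕ ℕ → ℤ := Sum.elim (fun n => x - 1 - (n : ℤ)) (fun n => x + 1 + (n : ℤ))
  have hg : g.Injective := by
    rintro (a | a) (b | b) h <;> simp [g] at h ⊢ <;> omega
  have hx : ∀ b, x ≠ g b := by
    rintro (b | b) <;> simp only [g, Sum.elim_inl, Sum.elim_inr] <;> omega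
  have hcomp : (fun z : ℤ → Bool × ℝ => (z x, (leftOf z x, rightOf z x))) =
      Prod.map id (fun w : ℕ ⊕ ℕ → Bool × ℝ => (fun a => w (Sum.inl a), fun b => w (Sum.inr b))) ∘
        fun z => (z x, fun b => z (g b)) := rfl
  rw [hcomp, ← map_map (by fun_prop) (by fun_prop), infinitePi_map_insert _ x hg hx,
    ← map_prod_map _ _ (by fun_prop) (by fun_prop), Measure.map_id,
    infinitePi_map_disjoint _ Sum.inl_injective Sum.inr_injective (by simp)]

/-- Opinion one is lost with probability `ν{1} ∫ e^{-u} f_1 ^ 2` and gained with probability `ν{0} ∫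
e^{-u} f_0 ^ 2`; the squares come from the independence of the two sides. By `opposedProb_conserved`
the difference of the integrands is a constant times `e^{-u}`. -/
lemma real_majorityPath (t : ℝ≥0) (x : ℤ) :
    (infinitePi fun _ : ℤ => ν.prod (expMeasure 1)).real {z | majorityPath z t x = true} =
      ν.real {true} - (1 - Real.exp (-(t : ℝ))) *
        (ν.real {true} * ν.real {false} ^ 2 - ν.real {false} * ν.real {true} ^ 2) := by
  have hE : MeasurableSet {q | splitPath t q} := measurableSet_setOfPred.2 (measurable_splitPath t)
  have h1 : (infinitePi fun _ : ℤ => ν.prod (expMeasure 1)).real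
      {z | majorityPath z t x = true} =
      ((ν.prod (expMeasure 1)).prod ((sideLaw ν).prod (sideLaw ν))).real {q | splitPath t q} := by
    rw [← map_split ν x, map_measureReal_apply (measurable_split x) hE]
    simp only [majorityPath_eq_true_iff]
    rfl
  let k : Bool → ℝ → ℝ := fun c => (Set.Iic (t : ℝ)).indicator fun u => opposedProb ν c u ^ 2
  have hprod : ∀ b : Bool × ℝ, MeasurableSet
      ({z | Opposed b.1 b.2 z} ×ˢ {z | Opposed b.1 b.2 z}) ∧
      ((sideLaw ν).prod (sideLaw ν)).real ({z | Opposed b.1 b.2 z} ×ˢ {z | Opposed b.1 b.2 z}) =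
        opposedProb ν b.1 b.2 ^ 2 := fun b => by
    refine ⟨(measurableSet_opposed b).prod (measurableSet_opposed b), ?_⟩
    rw [measureReal_prod_prod, sq]
    rfl
  have h2 : ∀ b : Bool × ℝ,
      ((sideLaw ν).prod (sideLaw ν)).real (Prod.mk b ⁻¹' {q | splitPath t q}) =
        (if b.1 = true then 1 else 0) * (1 - k true b.2) +
          (if b.1 = false then 1 else 0) * k false b.2 := by
    rintro ⟨b, u⟩
    obtain ⟨hm, hp⟩ := hprod (b, u)
    by_cases hu : u ≤ t
    · cases b
      · have : Prod.mk (false, u) ⁻¹' {q | splitPath t q} =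
            {z | Opposed false u z} ×ˢ {z | Opposed false u z} := by
          ext z
          simp [splitPath, hu]
        rw [this, hp]
        simp [k, hu]
      · have : Prod.mk (true, u) ⁻¹' {q | splitPath t q} =
            ({z | Opposed true u z} ×ˢ {z | Opposed true u z})ᶜ := by
          ext z
          simp [splitPath, hu]
        rw [this, probReal_compl_eq_one_sub hm, hp]
        simp [k, hu]
    · cases b
      · have : Prod.mk (false, u) ⁻¹' {q | splitPath t q} = ∅ := by
          ext z
          simp [splitPath, hu]
        simp [this, k, hu]
      · have : Prod.mk (true, u) ⁻¹' {q | splitPath t q} = Set.univ := by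
          ext z
          simp [splitPath, hu]
        simp [this, k, hu]
  have hk : ∀ c (μ : Measure ℝ) [IsFiniteMeasure μ], Integrable (k c) μ := fun c μ _ =>
    (integrable_opposedProb_sq ν c μ).indicator measurableSet_Iic
  have hind : ∀ c, Integrable (fun b : Bool => if b = c then (1 : ℝ) else 0) ν := fun c =>
    .of_finite
  have hkint : ∀ c, ∫ u, k c u ∂(expMeasure 1) =
      ∫ u in (0 : ℝ)..t, Real.exp (-u) * opposedProb ν c u ^ 2 := fun c => by
    rw [integral_indicator measurableSet_Iic, setIntegral_expMeasure t.coe_nonneg]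
  have hii : ∀ c, IntervalIntegrable (fun u => Real.exp (-u) * opposedProb ν c u ^ 2) volume
      0 (t : ℝ) := fun c => by
    rw [intervalIntegrable_iff]
    refine Integrable.mul_bdd (c := 1) ?_
      ((measurable_opposedProb ν c).pow_const 2).aestronglyMeasurable (.of_forall fun u => ?_)
    · exact intervalIntegrable_iff.1 (Continuous.intervalIntegrable (by fun_prop) _ _)
    · rw [Real.norm_of_nonneg (sq_nonneg _)]
      exact pow_le_one₀ (opposedProb_nonneg ν c u) (opposedProb_le_one ν c u)
  rw [h1, prod_real_eq_integral _ _ hE]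
  simp only [h2]
  have hi1 : Integrable (fun b : Bool × ℝ => (if b.1 = true then (1 : ℝ) else 0) *
      (1 - k true b.2)) (ν.prod (expMeasure 1)) :=
    (hind true).mul_prod ((integrable_const 1).sub (hk true _))
  have hi2 : Integrable (fun b : Bool × ℝ => (if b.1 = false then (1 : ℝ) else 0) *
      k false b.2) (ν.prod (expMeasure 1)) := (hind false).mul_prod (hk false _)
  rw [integral_add hi1 hi2, integral_siteLaw ν true fun u => 1 - k true u,
    integral_siteLaw ν false, integral_sub (integrable_const _) (hk true _), hkint, hkint]
  have hdiff : ν.real {true} * (∫ u in (0 : ℝ)..t, Real.exp (-u) * opposedProb ν true u ^ 2) -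
      ν.real {false} * (∫ u in (0 : ℝ)..t, Real.exp (-u) * opposedProb ν false u ^ 2) =
      (1 - Real.exp (-(t : ℝ))) *
        (ν.real {true} * ν.real {false} ^ 2 - ν.real {false} * ν.real {true} ^ 2) := by
    rw [← intervalIntegral.integral_const_mul, ← intervalIntegral.integral_const_mul,
      ← intervalIntegral.integral_sub ((hii _).const_mul _) ((hii _).const_mul _)]
    have hexp : ∫ u in (0 : ℝ)..t, Real.exp (-u) = 1 - Real.exp (-(t : ℝ)) := by
      rw [intervalIntegral.integral_comp_neg, integral_exp]
      simp
    rw [← hexp, ← intervalIntegral.integral_mul_const]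
    refine intervalIntegral.integral_congr fun u hu => ?_
    rw [Set.uIcc_of_le t.coe_nonneg] at hu
    rw [← opposedProb_conserved ν hu.1]
    ring
  simp only [integral_const, probReal_univ, smul_eq_mul, mul_one]
  linarith

end Law


/-! ### The one-site marginals -/

section Marginals

open ProbabilityTheory Measure

/-- The distribution function of the opinion of a site at time `t` in median dynamics. -/
def profile (t p : ℝ) : ℝ :=
  3 * p ^ 2 - 2 * p ^ 3 - Real.exp (-t) * (p * (1 - p) * (2 * p - 1))

section Threshold

variable {S : Type*} [MeasurableSpace S] (ν : Measure S) [IsProbabilityMeasure ν]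
  {θ : S → Bool}

lemma measurable_thresholdData (hθ : Measurable θ) :
    Measurable fun (ω : (ℤ → S) × (ℤ → ℕ → ℝ)) (y : ℤ) => (θ (ω.1 y), ω.2 y 0) := by
  fun_prop

/-- The probability of opinion one in majority dynamics, when the initial opinions are obtained
by applying `θ` to i.i.d. variables. -/
lemma graphicalLaw_real_majorityPath (hθ : Measurable θ) (t : ℝ≥0) (x : ℤ) :
    (graphicalLaw ℤ ν).real {ω | majorityPath (fun y => (θ (ω.1 y), ω.2 y 0)) t x = true} =
      (ν.map θ).real {true} - (1 - Real.exp (-(t : ℝ))) *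
        ((ν.map θ).real {true} * (ν.map θ).real {false} ^ 2 -
          (ν.map θ).real {false} * (ν.map θ).real {true} ^ 2) := by
  have : IsProbabilityMeasure (ν.map θ) := isProbabilityMeasure_map hθ.aemeasurable
  have hmap : (graphicalLaw ℤ ν).map (fun ω y => (θ (ω.1 y), ω.2 y 0)) =
      infinitePi fun _ : ℤ => (ν.map θ).prod (expMeasure 1) := by
    have hp : (ν.map θ).prod (expMeasure 1) = (ν.prod (expMeasure 1)).map (Prod.map θ id) := by
      rw [← map_prod_map _ _ hθ measurable_id, Measure.map_id]
    have hc : (fun (ω : (ℤ → S) × (ℤ → ℕ → ℝ)) (y : ℤ) => (θ (ω.1 y), ω.2 y 0)) =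
        (fun z y => Prod.map θ id (z y)) ∘
          fun (ω : (ℤ → S) × (ℤ → ℕ → ℝ)) y => (ω.1 y, ω.2 y 0) := rfl
    rw [hc, ← map_map (by fun_prop) (by fun_prop), graphicalLaw_map,
      infinitePi_map_pi (fun _ : ℤ => ν.prod (expMeasure 1)) (f := fun _ => Prod.map θ id)
        (fun _ => hθ.prodMap measurable_id)]
    simp only [hp]
  rw [← real_majorityPath, ← hmap,
    map_measureReal_apply (measurable_thresholdData hθ) (measurableSet_majorityPath t x)]
  rfl

lemma measurableSet_threshold (hθ : Measurable θ) (t : ℝ≥0) (x : ℤ) :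
    MeasurableSet {ω : (ℤ → S) × (ℤ → ℕ → ℝ) |
      majorityPath (fun y => (θ (ω.1 y), ω.2 y 0)) t x = true} :=
  measurable_thresholdData hθ (measurableSet_majorityPath t x)

end Threshold

lemma majorityProb_eq (p : I) (t : ℝ≥0) (x : ℤ) :
    majorityProb intLine p t x = profile t p := by
  have hae : (fun ω : (ℤ → Bool) × (ℤ → ℕ → ℝ) =>
      evolution (majorityRule intLine) (rings ω.2) ω.1 t x)
      =ᵐ[graphicalLaw ℤ (bernoulliMeasure true false p)]
      fun ω => majorityPath (fun y => (ω.1 y, ω.2 y 0)) t x := by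
    filter_upwards [ae_graphicalLaw_goodGaps (bernoulliMeasure true false p)] with ω hω
    rw [hω.evolution_majority]
  have hm : Measurable fun ω : (ℤ → Bool) × (ℤ → ℕ → ℝ) =>
      majorityPath (fun y => (ω.1 y, ω.2 y 0)) t x :=
    measurable_to_bool (measurableSet_threshold measurable_id t x)
  rw [majorityProb, marginal, Measure.map_congr hae,
    map_measureReal_apply hm (measurableSet_singleton true)]
  refine (graphicalLaw_real_majorityPath (bernoulliMeasure true false p) measurable_id t x).trans ?_
  have h1 : (bernoulliMeasure true false p).real {true} = p := by
    rw [bernoulliMeasure_real_apply_of_mem_of_notMem] <;> simp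
  have h2 : (bernoulliMeasure true false p).real {false} = 1 - p := by
    rw [bernoulliMeasure_real_apply_of_notMem_of_mem] <;> simp
  rw [Measure.map_id, h1, h2, profile]
  ring

lemma ae_median_le_iff (p : I) (t : ℝ≥0) (x : ℤ) :
    {ω : (ℤ → I) × (ℤ → ℕ → ℝ) | evolution (medianRule intLine) (rings ω.2) ω.1 t x ≤ p}
      =ᵐ[graphicalLaw ℤ volume]
      {ω | majorityPath (fun y => (decide (ω.1 y ≤ p), ω.2 y 0)) t x = true} := by
  filter_upwards [ae_graphicalLaw_goodGaps (volume : Measure I)] with ω hω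
  refine propext ?_
  change _ ≤ p ↔ _ = true
  rw [median_evolution_le_iff hω.wellSpaced, hω.evolution_majority]

lemma measurable_decide_le (p : I) : Measurable fun a : I => decide (a ≤ p) :=
  measurable_to_bool <| by
    have : (fun a : I => decide (a ≤ p)) ⁻¹' {true} = Set.Iic p := by
      ext a
      simp
    rw [this]
    exact measurableSet_Iic

/-- The evolution is defined by choice, so measurability is obtained indirectly: its sublevel sets
agree almost everywhere with measurable events of `majorityPath`. -/
lemma aemeasurable_median (t : ℝ≥0) (x : ℤ) :
    AEMeasurable (fun ω : (ℤ → I) × (ℤ → ℕ → ℝ) =>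
      evolution (medianRule intLine) (rings ω.2) ω.1 t x) (graphicalLaw ℤ volume) := by
  refine NullMeasurable.aemeasurable ?_
  refine measurable_of_Iic (δ := NullMeasurableSpace ((ℤ → I) × (ℤ → ℕ → ℝ))
    (graphicalLaw ℤ volume)) fun p => ?_
  exact (measurableSet_threshold (measurable_decide_le p) t x).nullMeasurableSet.congr
    (ae_median_le_iff p t x).symm

lemma medianMarginal_real_Iic (p : I) (t : ℝ≥0) (x : ℤ) :
    (medianMarginal intLine t x).real (Set.Iic p) = profile t p := by
  have hd := measurable_decide_le p
  rw [medianMarginal, marginal, measureReal_def,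
    map_apply_of_aemeasurable (aemeasurable_median t x) measurableSet_Iic]
  have h := measure_congr (ae_median_le_iff p t x)
  refine (congrArg ENNReal.toReal h).trans ?_
  refine (graphicalLaw_real_majorityPath (volume : Measure I) hd t x).trans ?_
  -- A uniform opinion thresholded at `p` is Bernoulli with parameter `p`.
  have h1 : ((volume : Measure I).map fun a => decide (a ≤ p)).real {true} = p := by
    have : (fun a : I => decide (a ≤ p)) ⁻¹' {true} = Set.Iic p := by
      ext a
      simp
    rw [map_measureReal_apply hd (measurableSet_singleton _), this, measureReal_def,
      unitInterval.volume_Iic, ENNReal.toReal_ofReal p.2.1]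
  have h2 : ((volume : Measure I).map fun a => decide (a ≤ p)).real {false} = 1 - p := by
    have := isProbabilityMeasure_map (μ := (volume : Measure I)) hd.aemeasurable
    rw [← h1, ← probReal_compl_eq_one_sub (measurableSet_singleton _)]
    congr 1
    ext b
    cases b <;> simp
  rw [h1, h2, profile]
  ring

/-! ### Monotonicity, convexity and the density -/

/-- Time enters only through `e^{-t} p (1 - p) (1 - 2p)`, whose coefficient is nonnegative for these
`p`. -/
lemma antitone_profile {p : ℝ} (h0 : 0 ≤ p) (hp : p ≤ 1 / 2) : Antitone fun t => profile t p := by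
  intro s t hst
  have he : Real.exp (-t) ≤ Real.exp (-s) := Real.exp_le_exp.2 (neg_le_neg hst)
  have hn : 0 ≤ p * (1 - p) * (1 - 2 * p) :=
    mul_nonneg (mul_nonneg h0 (by linarith)) (by linarith)
  simp only [profile]
  nlinarith [mul_nonneg (sub_nonneg.2 he) hn]

lemma convexOn_profile {t : ℝ} (ht : 0 ≤ t) : ConvexOn ℝ (Set.Icc 0 (1 / 2)) (profile t) := by
  refine ⟨convex_Icc _ _, ?_⟩
  rintro x ⟨hx0, hx⟩ y ⟨hy0, hy⟩ a b ha hb hab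
  have he : Real.exp (-t) ≤ 1 := Real.exp_le_one_iff.2 (by linarith)
  obtain rfl : b = 1 - a := by linarith
  -- Since `profile t p = e^{-t} p + (1 - e^{-t}) (3p² - 2p³)`, the linear part drops out of the
  -- convexity gap, and the gap of the cubic factors. The weights `1 + a` and `2 - a` sum to `3`, so
  -- the last factor is nonnegative for `x, y ≤ 1/2`.
  have hid : a • profile t x + (1 - a) • profile t y - profile t (a • x + (1 - a) • y) =
      (1 - Real.exp (-t)) * (a * (1 - a) * (x - y) ^ 2 *
        (3 - 2 * ((1 + a) * x + (2 - a) * y))) := by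
    simp only [profile, smul_eq_mul]
    ring
  have h3 : 0 ≤ 3 - 2 * ((1 + a) * x + (2 - a) * y) := by
    nlinarith [mul_nonneg (show 0 ≤ 1 + a by linarith) (sub_nonneg.2 hx),
      mul_nonneg (show 0 ≤ 2 - a by linarith) (sub_nonneg.2 hy)]
  have h4 := mul_nonneg (sub_nonneg.2 he)
    (mul_nonneg (mul_nonneg (mul_nonneg ha hb) (sq_nonneg (x - y))) h3)
  linarith

/-- The derivative of `profile`. -/
def profileDensity (t a : ℝ) : ℝ :=
  6 * (a * (1 - a)) * (1 - Real.exp (-t)) + Real.exp (-t)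

lemma hasDerivAt_profile (t a : ℝ) : HasDerivAt (profile t) (profileDensity t a) a := by
  have h : HasDerivAt (profile t) (3 * (2 * a ^ 1) - 2 * (3 * a ^ 2) - Real.exp (-t) *
      ((1 * (1 - a) + a * (0 - 1)) * (2 * a - 1) + a * (1 - a) * (2 * 1 - 0))) a :=
    (((hasDerivAt_pow 2 a).const_mul 3).sub ((hasDerivAt_pow 3 a).const_mul 2)).sub
      ((((hasDerivAt_id a).mul ((hasDerivAt_const a (1 : ℝ)).sub (hasDerivAt_id a))).mul
        (((hasDerivAt_id a).const_mul 2).sub (hasDerivAt_const a (1 : ℝ)))).const_mul _)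
  refine h.congr_deriv ?_
  rw [profileDensity]
  ring

lemma profileDensity_nonneg {t a : ℝ} (ht : 0 ≤ t) (h0 : 0 ≤ a) (h1 : a ≤ 1) :
    0 ≤ profileDensity t a :=
  add_nonneg (mul_nonneg (mul_nonneg (by norm_num) (mul_nonneg h0 (by linarith)))
    (sub_nonneg.2 (Real.exp_le_one_iff.2 (by linarith)))) (Real.exp_pos _).le

lemma continuous_profileDensity (t : ℝ) : Continuous (profileDensity t) := by
  unfold profileDensity
  fun_prop

lemma profileDensity_symm (t a : ℝ) : profileDensity t (1 - a) = profileDensity t a := by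
  simp only [profileDensity]
  ring

lemma profileDensity_mono {t a b : ℝ} (ht : 0 ≤ t) (hab : a ≤ b) (hb : b ≤ 1 / 2) :
    profileDensity t a ≤ profileDensity t b := by
  have h1 : 0 ≤ 1 - Real.exp (-t) := sub_nonneg.2 (Real.exp_le_one_iff.2 (by linarith))
  have h2 : a * (1 - a) ≤ b * (1 - b) := by
    nlinarith [mul_nonneg (sub_nonneg.2 hab) (show 0 ≤ 1 - a - b by linarith)]
  have := mul_le_mul_of_nonneg_right h2 h1
  simp only [profileDensity]
  linarith

lemma setLIntegral_profileDensity (t : ℝ≥0) (p : I) :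
    ∫⁻ a in Set.Iic p, ENNReal.ofReal (profileDensity t (a : ℝ)) ∂(volume : Measure I) =
      ENNReal.ofReal (profile t p) := by
  let F : ℝ → ℝ≥0∞ := (Set.Iic (p : ℝ)).indicator fun a => ENNReal.ofReal (profileDensity t a)
  have h1 : ∀ a : I, (Set.Iic p).indicator
      (fun a : I => ENNReal.ofReal (profileDensity t (a : ℝ))) a = F a := by
    intro a
    simp only [F, Set.indicator_apply, Set.mem_Iic, Subtype.coe_le_coe]
  have hset : Set.Iic (p : ℝ) ∩ I = Set.Icc 0 (p : ℝ) := by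
    ext a
    simp only [Set.mem_inter_iff, Set.mem_Iic, Set.mem_Icc]
    exact ⟨fun h => ⟨h.2.1, h.1⟩, fun h => ⟨h.2, h.1, h.2.trans p.2.2⟩⟩
  rw [← lintegral_indicator measurableSet_Iic, lintegral_congr h1, unitInterval.volume_def,
    lintegral_subtype_comap measurableSet_Icc, setLIntegral_indicator measurableSet_Iic, hset,
    ← ofReal_integral_eq_lintegral_ofReal
      (continuous_profileDensity t).continuousOn.integrableOn_Icc,
    integral_Icc_eq_integral_Ioc, ← intervalIntegral.integral_of_le p.2.1,
    intervalIntegral.integral_eq_sub_of_hasDerivAt (fun a _ => hasDerivAt_profile t a)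
      ((continuous_profileDensity t).intervalIntegrable _ _)]
  · simp [profile]
  · filter_upwards [ae_restrict_mem measurableSet_Icc] with a ha
    exact profileDensity_nonneg t.coe_nonneg ha.1 (ha.2.trans p.2.2)

lemma medianMarginal_eq_withDensity (t : ℝ≥0) (x : ℤ) :
    medianMarginal intLine t x =
      (volume : Measure I).withDensity fun a => ENNReal.ofReal (profileDensity t (a : ℝ)) := by
  have : IsProbabilityMeasure (graphicalLaw ℤ (volume : Measure I)) := by
    unfold graphicalLaw
    infer_instance
  have : IsProbabilityMeasure (medianMarginal intLine t x) :=
    isProbabilityMeasure_map (aemeasurable_median t x)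
  refine ext_of_Iic _ _ fun p => ?_
  rw [withDensity_apply _ measurableSet_Iic, setLIntegral_profileDensity,
    ← medianMarginal_real_Iic p t x, ofReal_measureReal]

/-- The law has a density, hence no atoms, and the endpoint carries no mass. -/
lemma medianMarginal_real_Iio (p : I) (t : ℝ≥0) (x : ℤ) :
    (medianMarginal intLine t x).real (Set.Iio p) = profile t p := by
  rw [← medianMarginal_real_Iic p t x]
  refine measureReal_congr ?_
  rw [medianMarginal_eq_withDensity]
  exact (withDensity_absolutelyContinuous _ _).ae_eq Iio_ae_eq_Iic

end Marginals

end MedianDynamics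

end

theorem mainTheorem6 :
    -- the law of majority dynamics on the integers
    (∀ (p : I) (t : ℝ≥0) (x : ℤ),
      MedianDynamics.majorityProb MedianDynamics.intLine p t x =
        3 * (p : ℝ) ^ 2 - 2 * (p : ℝ) ^ 3 -
          Real.exp (-(t : ℝ)) * ((p : ℝ) * (1 - (p : ℝ)) * (2 * (p : ℝ) - 1))) ∧
    -- the same formula for the distribution function of median dynamics
    (∀ (p : I) (t : ℝ≥0) (x : ℤ),
      (MedianDynamics.medianMarginal MedianDynamics.intLine t x).real (Set.Iic p) =
        3 * (p : ℝ) ^ 2 - 2 * (p : ℝ) ^ 3 -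
          Real.exp (-(t : ℝ)) * ((p : ℝ) * (1 - (p : ℝ)) * (2 * (p : ℝ) - 1))) ∧
    -- monotonicity in time, for majority and for median dynamics
    (∀ (p : I) (x : ℤ), (p : ℝ) ≤ 1 / 2 →
      Antitone fun t : ℝ≥0 => MedianDynamics.majorityProb MedianDynamics.intLine p t x) ∧
    (∀ (α : I) (x : ℤ), (α : ℝ) ≤ 1 / 2 →
      Antitone fun t : ℝ≥0 =>
        (MedianDynamics.medianMarginal MedianDynamics.intLine t x).real (Set.Iio α)) ∧
    -- convexity in the initial density
    (∀ (t : ℝ≥0) (x : ℤ),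
      ConvexOn ℝ (Set.Icc (0 : ℝ) (1 / 2)) fun p : ℝ =>
        MedianDynamics.majorityProb MedianDynamics.intLine
          (Set.projIcc (0 : ℝ) 1 zero_le_one p) t x) ∧
    -- unimodality of the density of median dynamics
    (∀ (t : ℝ≥0) (x : ℤ), ∃ f : I → ℝ≥0∞, Measurable f ∧
      MedianDynamics.medianMarginal MedianDynamics.intLine t x =
        (volume : Measure I).withDensity f ∧
      (∀ a : I, f (unitInterval.symm a) = f a) ∧
      MonotoneOn f {a : I | (a : ℝ) ≤ 1 / 2}) := by
  refine ⟨MedianDynamics.majorityProb_eq, MedianDynamics.medianMarginal_real_Iic,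
    fun p x hp s t hst => ?_, fun α x hα s t hst => ?_, fun t x => ?_, fun t x => ?_⟩
  · simp only [MedianDynamics.majorityProb_eq]
    exact MedianDynamics.antitone_profile p.2.1 hp (NNReal.coe_le_coe.2 hst)
  · simp only [MedianDynamics.medianMarginal_real_Iio]
    exact MedianDynamics.antitone_profile α.2.1 hα (NNReal.coe_le_coe.2 hst)
  · refine (MedianDynamics.convexOn_profile t.coe_nonneg).congr fun p hp => ?_
    have hp1 : p ∈ Set.Icc (0 : ℝ) 1 := ⟨hp.1, hp.2.trans (by norm_num)⟩
    simp only [MedianDynamics.majorityProb_eq, Set.projIcc_of_mem zero_le_one hp1]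
  · refine ⟨fun a => ENNReal.ofReal (MedianDynamics.profileDensity t (a : ℝ)), ?_,
      MedianDynamics.medianMarginal_eq_withDensity t x, fun a => ?_, fun a _ b hb hab => ?_⟩
    · exact ((MedianDynamics.continuous_profileDensity t).measurable.comp
        measurable_subtype_coe).ennreal_ofReal
    · simp only [unitInterval.coe_symm_eq, MedianDynamics.profileDensity_symm]
    · exact ENNReal.ofReal_le_ofReal
        (MedianDynamics.profileDensity_mono t.coe_nonneg (Subtype.coe_le_coe.2 hab) hb)
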